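/- Let $k$ be an algebraically closed field, and let $p$ be its characteristic exponent ($p=\operatorname{char} k$ if $\operatorname{char} k>0$, and $p=1$ if $\operatorname{char}k=0$). Let $\mathcal O\cong k[[X,Y,Z]]$ be the completed local ring of a nonsingular threefold over $k$ at a closed point $P$, with maximal ideal $\mathfrak m$, let $q=p^e$ with $e\ge 0$, and let $\mathcal R=\bigoplus_{a\ge 0}(\mathcal I_a,a)$ be an idealistic filtration of i.f.g. type on $\mathcal O$: a finitely generated graded $\mathcal O$-algebra with $\mathcal O=\mathcal I_0\supset\mathcal I_1\supset\mathcal I_2\supset\cdots$ and $\mathcal I_1\ne 0$. We write $(f,a)\in\mathcal R$ for $f\in\mathcal I_a$. Assume $P\in\mathrm{Sing}(\mathcal R)$, i.e. $\mathcal I_a\subset\mathfrak m^a$ for all $a$. Let $\mathcal{DR}$ be the differential saturation of $\mathcal R$, whose level-$b$ ideal is generated by the elements $\delta f$ with $(f,a)\in\mathcal R$, $\delta$ a $k$-linear differential operator of degree at most $t$, and $b=\max\{a-t,0\}$. Let $H_x$, and possibly a second hypersurface germ $H_y$, be given at $P$ (the boundary components). Consider pairs consisting of an element $h\in\mathcal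 O$ and a regular system of parameters $(x,y,z)$ of $\mathcal O$. Assume $H_x=\{x=0\}$ and, if $H_y$ is given, $H_y=\{y=0\}$; if it is not given, $y$ is unrestricted and we put $H_y=\{y=0\}$. Call such a pair admissible if: 1. $\{(h,q)\}$ is a leading generator system (so $\tau=1$): the leading algebra $\bigoplus_a\{f\bmod\mathfrak m^{a+1}\mid (f,a)\in\mathcal{DR},\ f\in\mathfrak m^a\}$ is $k[z^{q}]$, $(h,q)\in\mathcal R$, and $h\equiv z^{q}\bmod \mathfrak m^{q+1}$; moreover $h=z^{q}+a_1z^{q-1}+\cdots+a_{q-1}z+a_{q}$ with $a_i\in k[[x,y]]$ and $\mathrm{ord}_P(a_i)>i$ for $1\le i\le q$; 2. there are $\alpha,\beta\in\mathbb Z_{\ge0}$ and $a\in\mathbb Z_{>0}$ (with $\beta=0$ if no second component is given) such that $(x^\alpha y^\beta,a)\in\mathcal R$ and, for every $(f,\lambda)\in\mathcal R$ with expansion $f=\sum_{b\ge0}c_bh^b$, $c_b\in\bigoplus_{j<q}k[[x,y]]z^j$, the constant term $c_0$ is divisible by $x^{\lceil\alpha\lambda/a\rceil}y^{\lceil\beta\lambda/a\rceil}$;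 3. $\mathcal R$ is saturated for the Hasse derivatives $\frac{\partial^n}{\partial z^n}$, $n\ge0$, formed in the coordinates $(x,y,z)$: $(f,\lambda)\in\mathcal R$ implies $\left(\frac{\partial^n f}{\partial z^n},\max\{\lambda-n,0\}\right)\in\mathcal R$. Assume that an admissible pair exists (the $\tau=1$ monomial case). Let $\xi_{H_x},\xi_{H_y}$ be the generic points of $H_x=\{x=0\}$ and $H_y=\{y=0\}$. For $*\in\{P,\xi_{H_x},\xi_{H_y}\}$ and an admissible pair put $$\mu(*)=\inf\left\{\frac{\mathrm{ord}_*(c_0)}{\lambda}\;\middle|\;(f,\lambda)\in\mathcal R,\ \lambda>0,\ f=\sum_b c_bh^b\right\},\qquad \mathrm{Slope}_{h,(x,y,z)}(*)=\min\left\{\frac{\mathrm{ord}_*(a_{q})}{q},\ \mu(*)\right\}.$$ Call $h$ well-adapted at $*$ with respect to $(x,y,z)$ if either $\mathrm{Slope}_{h,(x,y,z)}(*)=\mu(*)$, or $\mathrm{Slope}_{h,(x,y,z)}(*)=\mathrm{ord}_*(a_{q})/q<\mu(*)$ and the initial form $\mathrm{In}_*(a_{q})$ is not a $q$-th power. Here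 $\mathrm{In}_P$ is the sum of the terms of lowest degree, $\mathrm{In}_{\xi_{H_x}}$ is the sum $x^rg(y)$ of the terms with the lowest exponent $r$ of $x$, and $\mathrm{In}_{\xi_{H_y}}$ is defined likewise for $y$. Then: (1) There is an admissible pair $h,(x,y,z)$ such that $h$ is well-adapted simultaneously at $P$, $\xi_{H_x}$ and $\xi_{H_y}$ with respect to $(x,y,z)$. (2) For each $*\in\{P,\xi_{H_x},\xi_{H_y}\}$, the number $\mathrm{Slope}_{h,(x,y,z)}(*)$ is the same for all admissible pairs for which $h$ is well-adapted at $*$ with respect to $(x,y,z)$. Consequently $\mathrm{H}(*):=\mathrm{Slope}_{h,(x,y,z)}(*)$, for any admissible pair with $h$ well-adapted at $*$, is a uniquely defined invariant. -/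

import Mathlib

open scoped ENNReal

noncomputable section

namespace MonomialCase

/-- The completed local ring of a nonsingular threefold over `k` at a closed point `P`. -/
abbrev Loc (k : Type*) [Field k] : Type _ := MvPowerSeries (Fin 3) k

/-- Its maximal ideal. -/
abbrev maxIdeal (k : Type*) [Field k] : Ideal (Loc k) := IsLocalRing.maximalIdeal (Loc k)

/-! ### Idealistic filtrations of i.f.g. type -/

/-- A decreasing multiplicative sequence of ideals `I 0 = (1) ⊇ I 1 ⊇ I 2 ⊇ ⋯`, with `I 1 ≠ 0`,
whose graded algebra `⨁ I a` is finitely generated. The graded algebra is realised as the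
subalgebra of all polynomials over `Loc k` whose `a`-th coefficient lies in `I a`. The assertion
"`(f, a)` belongs to the filtration" is `f ∈ I a`. -/
structure IdealisticFiltration (k : Type*) [Field k] where
  I : ℕ → Ideal (Loc k)
  zero_level : I 0 = ⊤
  antitone : Antitone I
  mul_le : ∀ a b, I a * I b ≤ I (a + b)
  one_ne_bot : I 1 ≠ ⊥
  fg : ∃ S : Subalgebra (Loc k) (Polynomial (Loc k)),
    (∀ F, F ∈ S ↔ ∀ a, F.coeff a ∈ I a) ∧ S.FG

variable {k : Type*} [Field k]

/-- `P` belongs to the singular locus: `ord_P (I a) ≥ a` for all `a`. -/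
def IdealisticFiltration.SingularPoint (R : IdealisticFiltration k) : Prop :=
  ∀ a, R.I a ≤ maxIdeal k ^ a

/-- Differential operators over `k` of degree at most `t` (in the sense of Grothendieck):
degree `0` means linear over the ring, and degree at most `t + 1` means that all commutators with
multiplications have degree at most `t`. -/
def IsDiffOp : ℕ → (Loc k →ₗ[k] Loc k) → Prop
  | 0, D => ∀ a f, D (a * f) = a * D f
  | t + 1, D => ∀ a, IsDiffOp t (D ∘ₗ LinearMap.mulLeft k a - LinearMap.mulLeft k a ∘ₗ D)

/-- The level `b` ideal of the differential saturation, generated by all `δ f` with `f` of level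
`a`, `δ` of degree at most `t` and `b = max (a - t) 0` (subtraction in `ℕ` is truncated). -/
def IdealisticFiltration.diffSat (R : IdealisticFiltration k) (b : ℕ) : Ideal (Loc k) :=
  Ideal.span {g | ∃ (a t : ℕ) (D : Loc k →ₗ[k] Loc k) (f : Loc k),
    IsDiffOp t D ∧ f ∈ R.I a ∧ a - t = b ∧ g = D f}

/-- The degree `a` part of the leading algebra of the differential saturation, given by its
preimage under `m ^ a → m ^ a / m ^ (a + 1)`. -/
def IdealisticFiltration.leadingPart (R : IdealisticFiltration k) (a : ℕ) :
    Submodule k (Loc k) :=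
  ((R.diffSat a ⊓ maxIdeal k ^ a) ⊔ maxIdeal k ^ (a + 1)).restrictScalars k

/-- The leading algebra of the differential saturation is `k[z ^ q]`. -/
def IdealisticFiltration.LeadingAlgebraEq (R : IdealisticFiltration k) (q : ℕ) (z : Loc k) :
    Prop :=
  ∀ a, R.leadingPart a =
    Submodule.span k {f | q ∣ a ∧ f = z ^ a} ⊔ (maxIdeal k ^ (a + 1)).restrictScalars k

/-! ### Regular systems of parameters -/

/-- A triple `(x, y, z) = (X 0, X 1, X 2)` generating the maximal ideal. -/
def IsRegularSystem (X : Fin 3 → Loc k) : Prop :=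
  Ideal.span (Set.range X) = maxIdeal k

/-- The element `F(x, y)` of the subring `k[[x, y]]`. -/
def plane (X : Fin 3 → Loc k) (F : MvPowerSeries (Fin 2) k) : Loc k :=
  MvPowerSeries.subst ![X 0, X 1] F

/-- The `n`-th Hasse (divided) derivative in the third variable,
`x ^ i y ^ j z ^ l ↦ (l choose n) x ^ i y ^ j z ^ (l - n)`. -/
def hasseZ (n : ℕ) (F : MvPowerSeries (Fin 3) k) : MvPowerSeries (Fin 3) k :=
  fun d => (Nat.choose (d 2 + n) n : k) * MvPowerSeries.coeff (d + Finsupp.single 2 n) F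

/-- The filtration is saturated under all `∂ⁿ/∂zⁿ` formed with respect to `(x, y, z)`: the
derivative of `F(x, y, z)` is `(hasseZ n F)(x, y, z)`, and its level drops from `a` to
`max (a - n) 0`. -/
def IdealisticFiltration.ZSaturated (R : IdealisticFiltration k) (X : Fin 3 → Loc k) : Prop :=
  ∀ (a n : ℕ) (F : MvPowerSeries (Fin 3) k), MvPowerSeries.subst X F ∈ R.I a →
    MvPowerSeries.subst X (hasseZ n F) ∈ R.I (a - n)

/-- `f = ∑ c_b h ^ b` is the power series expansion with respect to `h` and `(x, y, z)`: each
coefficient is a polynomial in `z` of degree less than `q` over `k[[x, y]]`, and the series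
converges to `f` for the `m`-adic topology. -/
def IsExpansion (q : ℕ) (X : Fin 3 → Loc k) (h f : Loc k) (c : ℕ → Loc k) : Prop :=
  (∀ b, ∃ C : ℕ → MvPowerSeries (Fin 2) k,
    c b = ∑ j ∈ Finset.range q, plane X (C j) * X 2 ^ j) ∧
  ∀ n : ℕ, ∃ N₀ : ℕ, ∀ N, N₀ ≤ N →
    f - ∑ b ∈ Finset.range N, c b * h ^ b ∈ maxIdeal k ^ n

/-- `c₀` is the constant term of the expansion of `f` with respect to `h` and `(x, y, z)`. -/
def IsConstTerm (q : ℕ) (X : Fin 3 → Loc k) (h f c₀ : Loc k) : Prop :=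
  ∃ c, IsExpansion q X h f c ∧ c 0 = c₀

/-! ### The monomial situation with one element in the leading generator system -/

/-- The components through `P` of the (young part of the) boundary divisor: the ideal of `H_x`,
and the ideal of a second component `H_y` if there is one. -/
structure Boundary (k : Type*) [Field k] where
  Hx : Ideal (Loc k)
  Hy : Option (Ideal (Loc k))

/-- A choice of parameters `(x, y, z)`, of an element `h`, and of its coefficients
`a 1, …, a q ∈ k[[x, y]]`; the other values of `a` play no role. -/
structure Choice (k : Type*) [Field k] where
  X : Fin 3 → Loc k
  h : Loc k
  a : ℕ → MvPowerSeries (Fin 2) k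

/-- `{(h, q)}` is a leading generator system, with associated regular system of parameters
`(x, y, z)`. -/
structure IsLGS (R : IdealisticFiltration k) (q : ℕ) (X : Fin 3 → Loc k) (h : Loc k) : Prop where
  regular : IsRegularSystem X
  leading : R.LeadingAlgebraEq q (X 2)
  mem : h ∈ R.I q
  congr : h - X 2 ^ q ∈ maxIdeal k ^ (q + 1)

/-- The order of `f` with respect to `J`: the supremum of all `n` with `f ∈ J ^ n`. -/
def ordAt (J : Ideal (Loc k)) (f : Loc k) : ℕ∞ :=
  ⨆ n ∈ {n : ℕ | f ∈ J ^ n}, (n : ℕ∞)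

/-- There is a monomial `(x ^ α y ^ β, a)` in the boundary components which lies in the filtration
and whose `lam / a`-th power divides the constant term of every element of level `lam`. -/
def MonomialCondition (R : IdealisticFiltration k) (B : Boundary k) (q : ℕ)
    (X : Fin 3 → Loc k) (h : Loc k) : Prop :=
  ∃ α β a : ℕ, 0 < a ∧ (B.Hy = none → β = 0) ∧ X 0 ^ α * X 1 ^ β ∈ R.I a ∧
    ∀ (lam : ℕ) (f c₀ : Loc k), f ∈ R.I lam → IsConstTerm q X h f c₀ →
      X 0 ^ ⌈((α : ℚ) * lam) / a⌉₊ * X 1 ^ ⌈((β : ℚ) * lam) / a⌉₊ ∣ c₀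

/-- The requirements on `h` and `(x, y, z)` in the monomial case. -/
structure Situation (R : IdealisticFiltration k) (B : Boundary k) (q : ℕ) (D : Choice k) :
    Prop where
  lgs : IsLGS R q D.X D.h
  eq_x : Ideal.span {D.X 0} = B.Hx
  eq_y : ∀ J ∈ B.Hy, Ideal.span {D.X 1} = J
  weierstrass : D.h = D.X 2 ^ q + ∑ i ∈ Finset.Icc 1 q, plane D.X (D.a i) * D.X 2 ^ (q - i)
  ord_coeff : ∀ i ∈ Finset.Icc 1 q, (i : ℕ∞) < ordAt (maxIdeal k) (plane D.X (D.a i))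
  monomial : MonomialCondition R B q D.X D.h
  saturated : R.ZSaturated D.X

/-! ### Slope and well-adaptedness -/

/-- The points `P`, `ξ_{H_x}`, `ξ_{H_y}`. -/
inductive Place
  | P
  | xiX
  | xiY

/-- The prime ideal of a point. -/
def Place.ideal (X : Fin 3 → Loc k) : Place → Ideal (Loc k)
  | .P => maxIdeal k
  | .xiX => Ideal.span {X 0}
  | .xiY => Ideal.span {X 1}

/-- The weights of the variables of `k[[x, y]]` at a point. -/
def Place.weight : Place → Fin 2 → ℕ
  | .P => ![1, 1]
  | .xiX => ![1, 0]
  | .xiY => ![0, 1]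

/-- The initial form at a point: the sum of the terms of smallest degree at `P`, the sum
`x ^ r g(y)` of the terms with smallest exponent `r` of `x` at `ξ_{H_x}`, and likewise at
`ξ_{H_y}`. -/
def initialForm (pt : Place) (F : MvPowerSeries (Fin 2) k) : MvPowerSeries (Fin 2) k :=
  MvPowerSeries.weightedHomogeneousComponent pt.weight
    (MvPowerSeries.weightedOrder pt.weight F).toNat F

/-- The invariant `μ` at a point: the infimum of `ord (c₀) / lam` over all elements of positive
level `lam`, where `c₀` is the constant term of the expansion. -/
def mu (R : IdealisticFiltration k) (q : ℕ) (D : Choice k) (pt : Place) : ℝ≥0∞ :=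
  sInf {s | ∃ (lam : ℕ) (f c₀ : Loc k), 0 < lam ∧ f ∈ R.I lam ∧ IsConstTerm q D.X D.h f c₀ ∧
    s = (ordAt (pt.ideal D.X) c₀ : ℝ≥0∞) / (lam : ℝ≥0∞)}

/-- `ord (a_q) / q` at a point. -/
def ordRatio (q : ℕ) (D : Choice k) (pt : Place) : ℝ≥0∞ :=
  (ordAt (pt.ideal D.X) (plane D.X (D.a q)) : ℝ≥0∞) / (q : ℝ≥0∞)

/-- The slope of `h` at a point with respect to `(x, y, z)`. -/
def slope (R : IdealisticFiltration k) (q : ℕ) (D : Choice k) (pt : Place) : ℝ≥0∞ :=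
  min (ordRatio q D pt) (mu R q D pt)

/-- `h` is well-adapted at a point with respect to `(x, y, z)`. -/
def WellAdapted (R : IdealisticFiltration k) (q : ℕ) (D : Choice k) (pt : Place) : Prop :=
  slope R q D pt = mu R q D pt ∨
    (slope R q D pt = ordRatio q D pt ∧ ordRatio q D pt < mu R q D pt ∧
      ¬ ∃ G : MvPowerSeries (Fin 2) k, G ^ q = initialForm pt (D.a q))

end MonomialCase

end

/-! A regular system of parameters is an automorphism of the power series ring
(`IsRegularSystem.coord`), so computations take place in `k[[X, Y, Z]]`. All three places are
handled at once by weighted orders on `k[[X, Y]]` with weights (1,1), (1,0), (0,1). Write `q = p ^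
e`.

Two facts hold for every admissible pair. The infimum `μ` is attained at the monomial
(`IsMonomialDatum.mu_eq`), and the ratios `α/a`, `β/a` do not depend on the pair
(`IsMonomialDatum.mul_le_mul`), so `μ` is intrinsic. Moreover the derivative of `h` of order `q - i`
has level `i`, so the monomial condition makes `a_i` divisible by the monomial with exponents
`⌈αi/a⌉`, `⌈βi/a⌉` and gives `ord a_i ≥ i μ` for `1 ≤ i < q`.

Independence of the slope: a well-adapted pair has maximal slope (`WellAdapted.slope_le`). Suppose
`ord a_q = N` with `N/q < μ`, and another pair `h'`, `z'` has slope above `N/q`. The leading algebra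
forces `z'` to agree with a nonzero multiple of `z` modulo `m²`, so `z'` vanishes on a graph `z =
φ(x, y)`, where `h'` restricts to its last coefficient, of order above `N`. Dividing, `h' = c₀ + h
Q` with `Q` a unit and `ord c₀ > N`, because `μ > N/q`. Hence `φ^q + ∑ a_i φ^(q-i) + a_q` has order
above `N`. The mixed terms are too small to matter, so the initial form of `a_q` is that of
`(-φ)^q`, a `q`-th power (`exists_pow_eq_initialForm`), contrary to well-adaptedness.

Existence: replacing `z` by `z - ψ(x, y)` with `ψ ∈ m²` keeps `h` and admissibility
(`Situation.translate`) and turns `a_q` into `ψ^q + ∑ a_i ψ^(q-i) + a_q`. Since `k` is perfect, such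
translations remove from `a_q` every monomial `(x^u y^v)^q` with `u < α/a` or `v < β/a`
(`Situation.exists_clear_fst`, `Situation.exists_clear_snd`). Afterwards an initial form that is a
`q`-th power has order at least `q μ` at each place, which is well-adaptedness at all three
simultaneously (`Situation.wellAdapted_of_clear`). -/

open scoped ENNReal

noncomputable section

/-! ### The adic filtration of a power series ring -/

namespace MvPowerSeries

variable {σ k : Type*} [Field k]

/-- The power series with prescribed coefficients. -/
def ofCoeff (c : (σ →₀ ℕ) → k) : MvPowerSeries σ k := c

@[simp]
theorem coeff_ofCoeff (c : (σ →₀ ℕ) → k) (d : σ →₀ ℕ) : coeff d (ofCoeff c) = c d := rfl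

theorem mem_maximalIdeal_iff {f : MvPowerSeries σ k} :
    f ∈ IsLocalRing.maximalIdeal (MvPowerSeries σ k) ↔ constantCoeff f = 0 := by
  rw [IsLocalRing.mem_maximalIdeal, mem_nonunits_iff, isUnit_iff_constantCoeff, isUnit_iff_ne_zero,
    not_not]

/-- Each nonzero exponent is assigned to one variable occurring in it, so that the monomials of `f`
are distributed over the `X i` without overlap and can be divided. -/
theorem exists_sum_X_mul [Fintype σ] {f : MvPowerSeries σ k} {n : ℕ}
    (hf : ((n + 1 : ℕ) : ℕ∞) ≤ f.order) :
    ∃ g : σ → MvPowerSeries σ k, f = ∑ i, X i * g i ∧ ∀ i, (n : ℕ∞) ≤ (g i).order := by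
  classical
  have hch : ∀ d : σ →₀ ℕ, d ≠ 0 → ∃ i, d i ≠ 0 := fun d hd => by
    by_contra! h
    exact hd (Finsupp.ext h)
  have hz : ∀ d : σ →₀ ℕ, d.degree < n + 1 → coeff d f = 0 := fun d hd =>
    coeff_of_lt_order (lt_of_lt_of_le (by exact_mod_cast hd) hf)
  rcases isEmpty_or_nonempty σ with hσ | hσ
  · refine ⟨0, ?_, fun i => isEmptyElim i⟩
    ext d
    rw [Subsingleton.elim d 0, hz 0 (by simp)]
    simp
  choose! c hc using hch
  refine ⟨fun i => ofCoeff fun e =>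
    if c (e + Finsupp.single i 1) = i then coeff (e + Finsupp.single i 1) f else 0, ?_, fun i => ?_⟩
  · ext d
    rw [map_sum]
    have key : ∀ i (g : MvPowerSeries σ k), coeff d (X i * g) =
        if d i ≠ 0 then coeff (d - Finsupp.single i 1) g else 0 := by
      intro i g
      rw [X, coeff_monomial_mul]
      simp [Finsupp.single_le_iff, Nat.one_le_iff_ne_zero]
    simp only [key]
    by_cases hd : d = 0
    · subst hd
      simp [hz 0 (by simp)]
    · rw [Finset.sum_eq_single (c d)]
      · rw [if_pos (hc d hd), coeff_ofCoeff]
        have : d - Finsupp.single (c d) 1 + Finsupp.single (c d) 1 = d :=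
          tsub_add_cancel_of_le (by simpa [Nat.one_le_iff_ne_zero] using hc d hd)
        simp [this]
      · intro i _ hi
        split_ifs with h
        · have : d - Finsupp.single i 1 + Finsupp.single i 1 = d :=
            tsub_add_cancel_of_le (by simpa [Nat.one_le_iff_ne_zero] using h)
          rw [coeff_ofCoeff, this, if_neg (Ne.symm hi)]
        · rfl
      · simp
  · refine nat_le_order fun d hd => ?_
    rw [coeff_ofCoeff]
    split_ifs
    · exact hz _ (by simpa using hd)
    · rfl

theorem mem_maximalIdeal_pow_iff [Finite σ] {f : MvPowerSeries σ k} {n : ℕ} :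
    f ∈ IsLocalRing.maximalIdeal (MvPowerSeries σ k) ^ n ↔ (n : ℕ∞) ≤ f.order := by
  have := Fintype.ofFinite σ
  constructor
  · induction n generalizing f with
    | zero => simp
    | succ n ih =>
      intro h
      rw [pow_succ] at h
      refine Submodule.mul_induction_on h (fun a ha b hb => ?_) fun a b ha hb => ?_
      · refine le_trans ?_ le_order_mul
        push_cast
        exact add_le_add (ih ha) (one_le_order_iff_constCoeff_eq_zero.2 (mem_maximalIdeal_iff.1 hb))
      · exact le_trans (le_min ha hb) min_order_le_add
  · induction n generalizing f with
    | zero => simp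
    | succ n ih =>
      intro h
      obtain ⟨g, rfl, hg⟩ := exists_sum_X_mul h
      refine Ideal.sum_mem _ fun i _ => ?_
      rw [pow_succ']
      exact Ideal.mul_mem_mul (mem_maximalIdeal_iff.2 (by simp)) (ih (hg i))

theorem mem_maximalIdeal_pow_iff_coeff [Finite σ] {f : MvPowerSeries σ k} {n : ℕ} :
    f ∈ IsLocalRing.maximalIdeal (MvPowerSeries σ k) ^ n ↔
      ∀ d : σ →₀ ℕ, d.degree < n → coeff d f = 0 :=
  mem_maximalIdeal_pow_iff.trans
    ⟨fun h _ hd => coeff_of_lt_order (lt_of_lt_of_le (by exact_mod_cast hd) h), nat_le_order⟩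

theorem maximalIdeal_eq_span_X [Finite σ] :
    IsLocalRing.maximalIdeal (MvPowerSeries σ k) = Ideal.span (Set.range X) := by
  have := Fintype.ofFinite σ
  refine le_antisymm (fun f hf => ?_) (Ideal.span_le.2 ?_)
  · rw [← pow_one (IsLocalRing.maximalIdeal (MvPowerSeries σ k)), mem_maximalIdeal_pow_iff] at hf
    obtain ⟨g, rfl, -⟩ := exists_sum_X_mul (n := 0) (by simpa using hf)
    exact Ideal.sum_mem _ fun i _ => Ideal.mul_mem_right _ _ (Ideal.subset_span ⟨i, rfl⟩)
  · rintro _ ⟨i, rfl⟩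
    exact mem_maximalIdeal_iff.2 (by simp)

theorem eq_zero_of_forall_mem_maximalIdeal_pow [Finite σ] {f : MvPowerSeries σ k}
    (h : ∀ n, f ∈ IsLocalRing.maximalIdeal (MvPowerSeries σ k) ^ n) : f = 0 := by
  ext d
  exact mem_maximalIdeal_pow_iff_coeff.1 (h (d.degree + 1)) d (Nat.lt_succ_self _)

/-- Completeness: the coefficient at `d` is constant from index `d.degree + 1` on. -/
theorem exists_adic_limit [Finite σ] {s : ℕ → MvPowerSeries σ k}
    (h : ∀ n, s (n + 1) - s n ∈ IsLocalRing.maximalIdeal (MvPowerSeries σ k) ^ n) :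
    ∃ S, ∀ n, S - s n ∈ IsLocalRing.maximalIdeal (MvPowerSeries σ k) ^ n := by
  refine ⟨ofCoeff fun d => coeff d (s (d.degree + 1)), fun n => mem_maximalIdeal_pow_iff_coeff.2 ?_⟩
  intro d hd
  have key : ∀ m, d.degree + 1 ≤ m → coeff d (s m) = coeff d (s (d.degree + 1)) := by
    intro m hm
    induction m, hm using Nat.le_induction with
    | base => rfl
    | succ m hm ih =>
      rw [← ih, ← sub_eq_zero, ← map_sub]
      exact mem_maximalIdeal_pow_iff_coeff.1 (h m) d hm
  rw [map_sub, key n hd, coeff_ofCoeff, sub_self]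

end MvPowerSeries

/-- The kernels of the iterates stabilise at some `n`. An element killed by `f` has the form `f^n
y`, so `y` lies in the kernel of `f^(n+1)`, which equals that of `f^n`. -/
theorem RingHom.injective_of_surjective_of_isNoetherianRing {A : Type*} [CommRing A]
    [IsNoetherianRing A] (f : A →+* A) (hf : Function.Surjective f) : Function.Injective f := by
  have hs : ∀ n : ℕ, Function.Surjective ⇑(f ^ n) := fun n => by
    rw [RingHom.coe_pow]
    exact hf.iterate n
  let K : ℕ →o Ideal A :=
    { toFun := fun n => RingHom.ker (f ^ n)
      monotone' := monotone_nat_of_le_succ fun n x hx => by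
        rw [RingHom.mem_ker] at hx ⊢
        rw [pow_succ', RingHom.mul_def, RingHom.comp_apply, hx, map_zero] }
  obtain ⟨n, hn⟩ := monotone_stabilizes_iff_noetherian.2 ‹IsNoetherianRing A› K
  rw [injective_iff_map_eq_zero]
  intro x hx
  obtain ⟨y, rfl⟩ := hs n x
  have h1 : y ∈ K (n + 1) := by
    change (f ^ (n + 1)) y = 0
    rw [pow_succ', RingHom.mul_def, RingHom.comp_apply, hx]
  rw [← hn (n + 1) (Nat.le_succ n)] at h1
  exact h1

namespace MonomialCase

variable {k : Type*} [Field k]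

/-! ### Coordinates given by a regular system of parameters -/

theorem hasSubst_of_mem_maxIdeal {σ τ : Type*} [Finite σ] {X : σ → MvPowerSeries τ k}
    (hX : ∀ i, X i ∈ IsLocalRing.maximalIdeal (MvPowerSeries τ k)) : MvPowerSeries.HasSubst X :=
  MvPowerSeries.hasSubst_of_constantCoeff_zero fun i => MvPowerSeries.mem_maximalIdeal_iff.1 (hX i)

theorem IsRegularSystem.mem {X : Fin 3 → Loc k} (hX : IsRegularSystem X) (i : Fin 3) :
    X i ∈ maxIdeal k := by
  rw [← (hX : Ideal.span (Set.range X) = maxIdeal k)]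
  exact Ideal.subset_span ⟨i, rfl⟩

theorem IsRegularSystem.hasSubst {X : Fin 3 → Loc k} (hX : IsRegularSystem X) :
    MvPowerSeries.HasSubst X :=
  hasSubst_of_mem_maxIdeal hX.mem

theorem substAlgHom_mem_maximalIdeal_pow {σ τ : Type*} [Finite σ] {X : σ → MvPowerSeries τ k}
    (hX : ∀ i, X i ∈ IsLocalRing.maximalIdeal (MvPowerSeries τ k)) {F : MvPowerSeries σ k} {n : ℕ}
    (hF : F ∈ IsLocalRing.maximalIdeal (MvPowerSeries σ k) ^ n) :
    MvPowerSeries.substAlgHom (hasSubst_of_mem_maxIdeal hX) F ∈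
      IsLocalRing.maximalIdeal (MvPowerSeries τ k) ^ n := by
  have h := Ideal.mem_map_of_mem
    (MvPowerSeries.substAlgHom (R := k) (hasSubst_of_mem_maxIdeal hX)) hF
  rw [Ideal.map_pow] at h
  refine Ideal.pow_right_mono ?_ n h
  rw [MvPowerSeries.maximalIdeal_eq_span_X, Ideal.map_span, Ideal.span_le]
  rintro _ ⟨_, ⟨i, rfl⟩, rfl⟩
  rw [MvPowerSeries.substAlgHom_X]
  exact hX i

/-- One step of successive approximation: modulo the next power of the maximal ideal, coefficients
of products of parameters may be replaced by their constant terms. -/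
theorem IsRegularSystem.exists_subst_sub_mem {X : Fin 3 → Loc k} (hX : IsRegularSystem X) (n : ℕ)
    {f : Loc k} (hf : f ∈ maxIdeal k ^ n) :
    ∃ F ∈ maxIdeal k ^ n, f - MvPowerSeries.substAlgHom hX.hasSubst F ∈ maxIdeal k ^ (n + 1) := by
  induction n generalizing f with
  | zero =>
    refine ⟨MvPowerSeries.C (MvPowerSeries.constantCoeff f), by simp, ?_⟩
    rw [zero_add, pow_one, MvPowerSeries.mem_maximalIdeal_iff, map_sub, sub_eq_zero,
      ← MvPowerSeries.monomial_zero_eq_C_apply, MvPowerSeries.substAlgHom_monomial]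
    simp [MvPowerSeries.algebraMap_apply]
  | succ n ih =>
    rw [pow_succ'] at hf
    refine Submodule.mul_induction_on hf (fun a ha b hb => ?_) fun a b ha hb => ?_
    · obtain ⟨G, hG, hbG⟩ := ih hb
      rw [← (hX : Ideal.span (Set.range X) = maxIdeal k)] at ha
      obtain ⟨c, rfl⟩ := (Ideal.mem_span_range_iff_exists_fun).1 ha
      refine ⟨∑ i, MvPowerSeries.C (MvPowerSeries.constantCoeff (c i)) * MvPowerSeries.X i * G,
        Ideal.sum_mem _ fun i _ => ?_, ?_⟩
      · rw [pow_succ']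
        exact Ideal.mul_mem_mul (MvPowerSeries.mem_maximalIdeal_iff.2 (by simp)) hG
      · rw [map_sum, Finset.sum_mul, ← Finset.sum_sub_distrib]
        refine Ideal.sum_mem _ fun i _ => ?_
        rw [map_mul, map_mul, MvPowerSeries.substAlgHom_X, ← MvPowerSeries.monomial_zero_eq_C_apply,
          MvPowerSeries.substAlgHom_monomial]
        simp only [Finsupp.prod_zero_index]
        have e : ∀ u v x b s : Loc k, u * x * b - v * x * s =
            (u - v) * x * b + v * (x * (b - s)) := by intros; ring
        rw [e]
        refine Ideal.add_mem _ ?_ (Ideal.mul_mem_left _ _ ?_)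
        · rw [pow_succ', pow_succ', ← mul_assoc]
          refine Ideal.mul_mem_mul (Ideal.mul_mem_mul ?_ (hX.mem i)) hb
          rw [MvPowerSeries.mem_maximalIdeal_iff]
          simp [MvPowerSeries.algebraMap_apply]
        · rw [pow_succ']
          exact Ideal.mul_mem_mul (hX.mem i) hbG
    · obtain ⟨F, hF, hF'⟩ := ha
      obtain ⟨G, hG, hG'⟩ := hb
      refine ⟨F + G, Ideal.add_mem _ hF hG, ?_⟩
      rw [map_add, add_sub_add_comm]
      exact Ideal.add_mem _ hF' hG'

theorem IsRegularSystem.subst_surjective {X : Fin 3 → Loc k} (hX : IsRegularSystem X) :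
    Function.Surjective (MvPowerSeries.substAlgHom (R := k) hX.hasSubst) := by
  intro f
  have hstep : ∀ (n : ℕ) (G : Loc k), f - MvPowerSeries.substAlgHom hX.hasSubst G ∈ maxIdeal k ^ n →
      ∃ G', G' - G ∈ maxIdeal k ^ n ∧
        f - MvPowerSeries.substAlgHom hX.hasSubst G' ∈ maxIdeal k ^ (n + 1) := by
    intro n G hG
    obtain ⟨F, hF, hF'⟩ := hX.exists_subst_sub_mem n hG
    refine ⟨G + F, by simpa using hF, ?_⟩
    rwa [map_add, ← sub_sub]
  choose! g hg hg' using hstep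
  let s : ℕ → Loc k := fun n => Nat.rec 0 g n
  have hs : ∀ n, f - MvPowerSeries.substAlgHom hX.hasSubst (s n) ∈ maxIdeal k ^ n := by
    intro n
    induction n with
    | zero => simp
    | succ n ih => exact hg' n (s n) ih
  obtain ⟨S, hS⟩ := MvPowerSeries.exists_adic_limit (s := s) fun n => hg n (s n) (hs n)
  refine ⟨S, (sub_eq_zero.1
    (MvPowerSeries.eq_zero_of_forall_mem_maximalIdeal_pow fun n => ?_)).symm⟩
  have h := substAlgHom_mem_maximalIdeal_pow hX.mem (hS n)
  rw [map_sub] at h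
  simpa using Ideal.sub_mem _ (hs n) h

theorem IsRegularSystem.subst_bijective {X : Fin 3 → Loc k} (hX : IsRegularSystem X) :
    Function.Bijective (MvPowerSeries.substAlgHom (R := k) hX.hasSubst) :=
  ⟨RingHom.injective_of_surjective_of_isNoetherianRing
    (MvPowerSeries.substAlgHom (R := k) hX.hasSubst).toRingHom hX.subst_surjective,
    hX.subst_surjective⟩

/-- The automorphism `F ↦ F(x, y, z)` attached to a regular system of parameters. -/
def IsRegularSystem.coord {X : Fin 3 → Loc k} (hX : IsRegularSystem X) : Loc k ≃ₐ[k] Loc k :=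
  AlgEquiv.ofBijective (MvPowerSeries.substAlgHom hX.hasSubst) hX.subst_bijective

theorem IsRegularSystem.coord_apply {X : Fin 3 → Loc k} (hX : IsRegularSystem X) (F : Loc k) :
    hX.coord F = MvPowerSeries.subst X F := by
  rw [coord, AlgEquiv.ofBijective_apply, MvPowerSeries.substAlgHom_apply]

@[simp]
theorem IsRegularSystem.coord_X {X : Fin 3 → Loc k} (hX : IsRegularSystem X) (i : Fin 3) :
    hX.coord (MvPowerSeries.X i) = X i := by
  rw [hX.coord_apply, MvPowerSeries.subst_X hX.hasSubst]

@[simp]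
theorem IsRegularSystem.coord_symm {X : Fin 3 → Loc k} (hX : IsRegularSystem X) (i : Fin 3) :
    hX.coord.symm (X i) = MvPowerSeries.X i := by
  rw [AlgEquiv.symm_apply_eq, hX.coord_X]

theorem map_maxIdeal (E : Loc k ≃ₐ[k] Loc k) : Ideal.map E (maxIdeal k) = maxIdeal k := by
  ext f
  rw [Ideal.mem_map_iff_of_surjective _ E.surjective]
  simp only [IsLocalRing.mem_maximalIdeal, mem_nonunits_iff]
  constructor
  · rintro ⟨g, hg, rfl⟩
    simpa using hg
  · intro hf
    exact ⟨E.symm f, by simpa using hf, by simp⟩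

theorem map_mem_maxIdeal_pow_iff (E : Loc k ≃ₐ[k] Loc k) {f : Loc k} {n : ℕ} :
    E f ∈ maxIdeal k ^ n ↔ f ∈ maxIdeal k ^ n := by
  have key : ∀ (E : Loc k ≃ₐ[k] Loc k) (f : Loc k), f ∈ maxIdeal k ^ n → E f ∈ maxIdeal k ^ n := by
    intro E f hf
    have := Ideal.mem_map_of_mem E hf
    rwa [Ideal.map_pow, map_maxIdeal] at this
  exact ⟨fun h => by simpa using key E.symm _ h, key E f⟩

/-! ### Series in two variables and polynomials in `z` -/

/-- The inclusion of `k[[X, Y]]` into `k[[X, Y, Z]]`. -/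
def planeEmb : MvPowerSeries (Fin 2) k →ₐ[k] Loc k :=
  MvPowerSeries.rename (Fin.castSuccEmb : Fin 2 ↪ Fin 3)

@[simp]
theorem planeEmb_X (i : Fin 2) :
    planeEmb (MvPowerSeries.X i : MvPowerSeries (Fin 2) k) = MvPowerSeries.X i.castSucc :=
  MvPowerSeries.rename_X _ i

theorem subst_planeEmb {τ : Type*} {X : Fin 3 → MvPowerSeries τ k} (hX : MvPowerSeries.HasSubst X)
    (F : MvPowerSeries (Fin 2) k) :
    MvPowerSeries.subst X (planeEmb F) = MvPowerSeries.subst ![X 0, X 1] F := by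
  rw [planeEmb, MvPowerSeries.rename_eq_subst,
    MvPowerSeries.subst_comp_subst_apply (MvPowerSeries.HasSubst.X_comp _) hX]
  congr 1
  funext i
  fin_cases i <;> simp [MvPowerSeries.subst_X hX]

theorem IsRegularSystem.plane_eq {X : Fin 3 → Loc k} (hX : IsRegularSystem X)
    (F : MvPowerSeries (Fin 2) k) : plane X F = hX.coord (planeEmb F) := by
  rw [hX.coord_apply, subst_planeEmb hX.hasSubst, plane]

/-- Restriction of an exponent to the first two variables. -/
def planeExp (d : Fin 3 →₀ ℕ) : Fin 2 →₀ ℕ :=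
  d.comapDomain Fin.castSucc (Fin.castSucc_injective 2).injOn

theorem embDomain_castSuccEmb_two (e : Fin 2 →₀ ℕ) :
    e.embDomain (Fin.castSuccEmb : Fin 2 ↪ Fin 3) 2 = 0 := by
  rw [Finsupp.embDomain_of_notMem_range]
  rintro ⟨i, hi⟩
  fin_cases i <;> simp [Fin.ext_iff] at hi

theorem embDomain_planeExp_add (d : Fin 3 →₀ ℕ) :
    (planeExp d).embDomain Fin.castSuccEmb + Finsupp.single 2 (d 2) = d := by
  ext i
  fin_cases i
  · have := Finsupp.embDomain_apply_self (Fin.castSuccEmb : Fin 2 ↪ Fin 3) (planeExp d) 0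
    simpa [planeExp] using this
  · have := Finsupp.embDomain_apply_self (Fin.castSuccEmb : Fin 2 ↪ Fin 3) (planeExp d) 1
    simpa [planeExp] using this
  · simp [embDomain_castSuccEmb_two]

theorem coeff_planeEmb_mul_X_pow (F : MvPowerSeries (Fin 2) k) (j : ℕ) (d : Fin 3 →₀ ℕ) :
    MvPowerSeries.coeff d (planeEmb F * MvPowerSeries.X 2 ^ j) =
      if d 2 = j then MvPowerSeries.coeff (planeExp d) F else 0 := by
  classical
  rw [MvPowerSeries.X_pow_eq, MvPowerSeries.coeff_mul_monomial]
  simp only [Finsupp.single_le_iff, mul_one]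
  rcases lt_trichotomy (d 2) j with h | h | h
  · rw [if_neg (by omega), if_neg (by omega)]
  · rw [if_pos h.ge, if_pos h]
    have : d - Finsupp.single 2 j =
        Finsupp.embDomain (Fin.castSuccEmb : Fin 2 ↪ Fin 3) (planeExp d) :=
      tsub_eq_of_eq_add (by rw [← h, embDomain_planeExp_add])
    rw [this, planeEmb, MvPowerSeries.coeff_embDomain_rename]
  · rw [if_pos h.le, if_neg h.ne', planeEmb, MvPowerSeries.coeff_rename_eq_zero]
    rintro ⟨e, he⟩
    have h2 : (Finsupp.mapDomain (Fin.castSuccEmb : Fin 2 ↪ Fin 3) e) 2 = 0 := by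
      rw [← Finsupp.embDomain_eq_mapDomain, embDomain_castSuccEmb_two]
    rw [he] at h2
    simp at h2
    omega

/-- Polynomials in `Z` over `k[[X, Y]]` as elements of `k[[X, Y, Z]]`. -/
def zPoly : Polynomial (MvPowerSeries (Fin 2) k) →+* Loc k :=
  Polynomial.eval₂RingHom (planeEmb : MvPowerSeries (Fin 2) k →ₐ[k] Loc k).toRingHom
    (MvPowerSeries.X 2)

theorem zPoly_C (F : MvPowerSeries (Fin 2) k) : zPoly (Polynomial.C F) = planeEmb F := by
  simp [zPoly]

theorem zPoly_X : zPoly (Polynomial.X : Polynomial (MvPowerSeries (Fin 2) k)) =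
    MvPowerSeries.X 2 := by
  simp [zPoly]

theorem zPoly_monomial (F : MvPowerSeries (Fin 2) k) (j : ℕ) :
    zPoly (Polynomial.monomial j F) = planeEmb F * MvPowerSeries.X 2 ^ j := by
  simp [zPoly]

theorem coeff_zPoly (P : Polynomial (MvPowerSeries (Fin 2) k)) (d : Fin 3 →₀ ℕ) :
    MvPowerSeries.coeff d (zPoly P) = MvPowerSeries.coeff (planeExp d) (P.coeff (d 2)) := by
  induction P using Polynomial.induction_on' with
  | add P Q hP hQ => simp [hP, hQ]
  | monomial n F =>
    rw [zPoly_monomial, coeff_planeEmb_mul_X_pow, Polynomial.coeff_monomial]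
    split_ifs with h1 h2 h2 <;> simp_all

theorem IsRegularSystem.coord_zPoly {X : Fin 3 → Loc k} (hX : IsRegularSystem X)
    (P : Polynomial (MvPowerSeries (Fin 2) k)) {q : ℕ} (hq : P.natDegree < q) :
    hX.coord (zPoly P) = ∑ j ∈ Finset.range q, plane X (P.coeff j) * X 2 ^ j := by
  conv_lhs => rw [P.as_sum_range' q hq]
  rw [map_sum, map_sum]
  refine Finset.sum_congr rfl fun j _ => ?_
  rw [zPoly_monomial, map_mul, map_pow, hX.coord_X, hX.plane_eq]

theorem hasSubst_evalZ {φ : MvPowerSeries (Fin 2) k}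
    (hφ : φ ∈ IsLocalRing.maximalIdeal (MvPowerSeries (Fin 2) k)) :
    MvPowerSeries.HasSubst ![MvPowerSeries.X 0, MvPowerSeries.X 1, φ] :=
  hasSubst_of_mem_maxIdeal fun i => by
    fin_cases i
    · exact MvPowerSeries.mem_maximalIdeal_iff.2 (by simp)
    · exact MvPowerSeries.mem_maximalIdeal_iff.2 (by simp)
    · exact hφ

/-- The substitution `Z ↦ φ(X, Y)`. -/
def evalZ (φ : MvPowerSeries (Fin 2) k)
    (hφ : φ ∈ IsLocalRing.maximalIdeal (MvPowerSeries (Fin 2) k)) :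
    Loc k →ₐ[k] MvPowerSeries (Fin 2) k :=
  MvPowerSeries.substAlgHom (hasSubst_evalZ hφ)

section evalZ

variable {φ : MvPowerSeries (Fin 2) k}
  (hφ : φ ∈ IsLocalRing.maximalIdeal (MvPowerSeries (Fin 2) k))

theorem evalZ_X (i : Fin 3) : evalZ φ hφ (MvPowerSeries.X i) =
    ![MvPowerSeries.X 0, MvPowerSeries.X 1, φ] i := by
  rw [evalZ, MvPowerSeries.substAlgHom_X]

@[simp]
theorem evalZ_planeEmb (F : MvPowerSeries (Fin 2) k) : evalZ φ hφ (planeEmb F) = F := by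
  rw [evalZ, MvPowerSeries.substAlgHom_apply, subst_planeEmb (hasSubst_evalZ hφ)]
  · have : ![MvPowerSeries.X 0, MvPowerSeries.X 1] =
        (MvPowerSeries.X : Fin 2 → MvPowerSeries (Fin 2) k) := by
      funext i
      fin_cases i <;> rfl
    simp only [Matrix.cons_val_zero, Matrix.cons_val_one]
    rw [this, MvPowerSeries.subst_self, id]

@[simp]
theorem evalZ_zPoly (P : Polynomial (MvPowerSeries (Fin 2) k)) :
    evalZ φ hφ (zPoly P) = P.eval φ := by
  induction P using Polynomial.induction_on' with
  | add P Q hP hQ => simp [hP, hQ]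
  | monomial n F => simp [zPoly_monomial, evalZ_X]

end evalZ

/-! ### Weierstrass division -/

/-- The terms of `F` of degree less than `q` in `Z`, as a polynomial in `Z`. -/
def lowPoly (q : ℕ) (F : Loc k) : Polynomial (MvPowerSeries (Fin 2) k) :=
  ∑ j ∈ Finset.range q, Polynomial.monomial j (MvPowerSeries.ofCoeff fun e =>
    MvPowerSeries.coeff (e.embDomain Fin.castSuccEmb + Finsupp.single 2 j) F)

/-- The quotient by `Z ^ q` of the terms of `F` of degree at least `q` in `Z`. -/
def highPart (q : ℕ) (F : Loc k) : Loc k :=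
  MvPowerSeries.ofCoeff fun d => MvPowerSeries.coeff (d + Finsupp.single 2 q) F

theorem natDegree_lowPoly_lt {q : ℕ} (hq : 0 < q) (F : Loc k) : (lowPoly q F).natDegree < q := by
  refine lt_of_le_of_lt (Polynomial.natDegree_sum_le_of_forall_le (n := q - 1) _ _ fun j hj => ?_)
    (by omega)
  have := Finset.mem_range.1 hj
  exact (Polynomial.natDegree_monomial_le _).trans (by omega)

theorem coeff_zPoly_lowPoly (q : ℕ) (F : Loc k) (d : Fin 3 →₀ ℕ) :
    MvPowerSeries.coeff d (zPoly (lowPoly q F)) =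
      if d 2 < q then MvPowerSeries.coeff d F else 0 := by
  rw [coeff_zPoly, lowPoly, Polynomial.finsetSum_coeff]
  simp only [Polynomial.coeff_monomial]
  split_ifs with h
  · rw [Finset.sum_eq_single (d 2)]
    · rw [if_pos rfl, MvPowerSeries.coeff_ofCoeff, embDomain_planeExp_add]
    · intro j _ hj
      rw [if_neg hj]
    · simp [h]
  · rw [Finset.sum_eq_zero, map_zero]
    intro j hj
    rw [if_neg]
    rintro rfl
    exact h (Finset.mem_range.1 hj)

theorem coeff_X_pow_mul_Z (q : ℕ) (G : Loc k) (d : Fin 3 →₀ ℕ) :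
    MvPowerSeries.coeff d (MvPowerSeries.X 2 ^ q * G) =
      if q ≤ d 2 then MvPowerSeries.coeff (d - Finsupp.single 2 q) G else 0 := by
  rw [MvPowerSeries.X_pow_eq, MvPowerSeries.coeff_monomial_mul]
  simp [Finsupp.single_le_iff]

theorem lowPoly_add_highPart (q : ℕ) (F : Loc k) :
    F = zPoly (lowPoly q F) + MvPowerSeries.X 2 ^ q * highPart q F := by
  ext d
  rw [map_add, coeff_zPoly_lowPoly, coeff_X_pow_mul_Z]
  by_cases h : d 2 < q
  · rw [if_pos h, if_neg (by omega), add_zero]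
  · rw [if_neg h, if_pos (by omega), zero_add, highPart, MvPowerSeries.coeff_ofCoeff,
      tsub_add_cancel_of_le (by simpa [Finsupp.single_le_iff] using h)]

theorem highPart_mem {q n : ℕ} {F : Loc k} (hF : F ∈ maxIdeal k ^ n) :
    highPart q F ∈ maxIdeal k ^ (n - q) := by
  rw [MvPowerSeries.mem_maximalIdeal_pow_iff_coeff] at hF ⊢
  intro d hd
  refine hF _ ?_
  rw [map_add, Finsupp.degree_single]
  omega

/-- Weierstrass division by a series with leading term `Z ^ q`. -/
theorem exists_weierstrass_division {q : ℕ} (hq : 0 < q) {H : Loc k}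
    (hH : H - MvPowerSeries.X 2 ^ q ∈ maxIdeal k ^ (q + 1)) (F : Loc k) :
    ∃ (P : Polynomial (MvPowerSeries (Fin 2) k)) (Q : Loc k),
      P.natDegree < q ∧ F = zPoly P + H * Q := by
  set ε := H - MvPowerSeries.X 2 ^ q with hε
  -- Since `Z^q = H - ε`, splitting `G` into its low part and `Z^q` times its high part leaves,
  -- modulo `H`, the remainder `-ε * highPart q G`, of order one higher.
  let r : ℕ → Loc k := fun n => Nat.rec F (fun _ G => -(ε * highPart q G)) n
  have r_succ : ∀ n, r (n + 1) = -(ε * highPart q (r n)) := fun n => rfl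
  have r_mem : ∀ n, r n ∈ maxIdeal k ^ n := by
    intro n
    induction n with
    | zero => simp
    | succ n ih =>
      rw [r_succ, neg_mem_iff]
      have := Ideal.mul_mem_mul hH (highPart_mem (q := q) ih)
      rw [← pow_add] at this
      exact Ideal.pow_le_pow_right (by omega) this
  have hsum : ∀ n, F = zPoly (∑ i ∈ Finset.range n, lowPoly q (r i)) +
      H * (∑ i ∈ Finset.range n, highPart q (r i)) + r n := by
    intro n
    induction n with
    | zero => simp [r]
    | succ n ih =>
      rw [Finset.sum_range_succ, Finset.sum_range_succ, map_add, r_succ]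
      conv_lhs => rw [ih, lowPoly_add_highPart q (r n)]
      rw [hε]
      ring
  -- Taking the high part loses `q` orders; the shift by `q` restores convergence at the required
  -- rate.
  obtain ⟨B, hB⟩ := MvPowerSeries.exists_adic_limit
    (s := fun n => ∑ i ∈ Finset.range (n + q), highPart q (r i)) fun n => by
      rw [show n + 1 + q = n + q + 1 by ring, Finset.sum_range_succ, add_sub_cancel_left]
      have := highPart_mem (q := q) (r_mem (n + q))
      rwa [Nat.add_sub_cancel] at this
  have hA : ∀ d : Fin 3 →₀ ℕ, q ≤ d 2 → MvPowerSeries.coeff d (F - H * B) = 0 := by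
    intro d hd
    set n := d.degree + 1 with hn
    have hmem : F - H * B - zPoly (∑ i ∈ Finset.range (n + q), lowPoly q (r i)) ∈
        maxIdeal k ^ n := by
      have e : F - H * B - zPoly (∑ i ∈ Finset.range (n + q), lowPoly q (r i)) =
          r (n + q) - H * (B - ∑ i ∈ Finset.range (n + q), highPart q (r i)) := by
        conv_lhs => rw [hsum (n + q)]
        ring
      rw [e]
      exact Ideal.sub_mem _ (Ideal.pow_le_pow_right (by omega) (r_mem _))
        (Ideal.mul_mem_left _ _ (hB n))
    have h0 := MvPowerSeries.mem_maximalIdeal_pow_iff_coeff.1 hmem d (by omega)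
    rw [map_sub, map_sum, map_sum, Finset.sum_eq_zero, sub_zero] at h0
    · exact h0
    · intro i _
      rw [coeff_zPoly_lowPoly, if_neg (by omega)]
  refine ⟨lowPoly q (F - H * B), B, natDegree_lowPoly_lt hq _, ?_⟩
  rw [← sub_eq_iff_eq_add]
  ext d
  rw [coeff_zPoly_lowPoly]
  split_ifs with h
  · rfl
  · exact hA d (by omega)

/-! ### Constant terms of expansions -/

section expansion

variable {X : Fin 3 → Loc k} {q : ℕ}

theorem exists_sum_plane_iff (hX : IsRegularSystem X) (hq : 0 < q) (c : Loc k) :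
    (∃ C : ℕ → MvPowerSeries (Fin 2) k, c = ∑ j ∈ Finset.range q, plane X (C j) * X 2 ^ j) ↔
      ∃ P : Polynomial (MvPowerSeries (Fin 2) k), P.natDegree < q ∧ c = hX.coord (zPoly P) := by
  constructor
  · rintro ⟨C, rfl⟩
    have hdeg : (∑ j ∈ Finset.range q, Polynomial.monomial j (C j)).natDegree < q := by
      refine lt_of_le_of_lt
        (Polynomial.natDegree_sum_le_of_forall_le (n := q - 1) _ _ fun j hj => ?_) (by omega)
      have := Finset.mem_range.1 hj
      exact (Polynomial.natDegree_monomial_le _).trans (by omega)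
    refine ⟨_, hdeg, ?_⟩
    rw [map_sum, map_sum]
    refine Finset.sum_congr rfl fun j _ => ?_
    rw [zPoly_monomial, map_mul, map_pow, hX.coord_X, hX.plane_eq]
  · rintro ⟨P, hP, rfl⟩
    exact ⟨P.coeff, hX.coord_zPoly P hP⟩

theorem isConstTerm_self (hX : IsRegularSystem X) (hq : 0 < q) (h : Loc k)
    {P : Polynomial (MvPowerSeries (Fin 2) k)} (hP : P.natDegree < q) :
    IsConstTerm q X h (hX.coord (zPoly P)) (hX.coord (zPoly P)) := by
  refine ⟨fun b => if b = 0 then hX.coord (zPoly P) else 0,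
    ⟨fun b => ?_, fun n => ⟨1, ?_⟩⟩, by simp⟩
  · rw [exists_sum_plane_iff hX hq]
    by_cases hb : b = 0
    · exact ⟨P, hP, by simp [hb]⟩
    · exact ⟨0, by simpa using hq, by simp [hb]⟩
  · intro N hN
    rw [Finset.sum_eq_single 0]
    · simp
    · intro b _ hb
      simp [hb]
    · intro h0
      exact absurd (Finset.mem_range.2 (by omega)) h0

theorem isConstTerm_plane (hX : IsRegularSystem X) (hq : 0 < q) (h : Loc k)
    (F : MvPowerSeries (Fin 2) k) :
    IsConstTerm q X h (plane X F) (plane X F) := by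
  have := isConstTerm_self hX hq h (P := Polynomial.C F) (by simpa using hq)
  rwa [zPoly_C, ← hX.plane_eq] at this

/-- Multiplication by a series in `x, y` does not raise the degree in `z`, so it acts termwise on
expansions. -/
theorem IsConstTerm.plane_mul (hX : IsRegularSystem X) {h f c₀ : Loc k}
    (hc : IsConstTerm q X h f c₀) (G : MvPowerSeries (Fin 2) k) :
    IsConstTerm q X h (plane X G * f) (plane X G * c₀) := by
  obtain ⟨c, ⟨h1, h2⟩, rfl⟩ := hc
  refine ⟨fun b => plane X G * c b, ⟨fun b => ?_, fun n => ?_⟩, rfl⟩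
  · obtain ⟨C, hC⟩ := h1 b
    refine ⟨fun j => G * C j, ?_⟩
    change plane X G * c b = _
    rw [hC, Finset.mul_sum]
    refine Finset.sum_congr rfl fun j _ => ?_
    simp only [hX.plane_eq, map_mul]
    ring
  · obtain ⟨N₀, hN⟩ := h2 n
    refine ⟨N₀, fun N hN' => ?_⟩
    have e : plane X G * f - ∑ b ∈ Finset.range N, plane X G * c b * h ^ b =
        plane X G * (f - ∑ b ∈ Finset.range N, c b * h ^ b) := by
      rw [mul_sub, Finset.mul_sum]
      simp only [mul_assoc]
    rw [e]
    exact Ideal.mul_mem_left _ _ (hN N hN')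

/-- The expansion comes from iterating Weierstrass division on the successive quotients. The
relation `f = c₀ + h Q` from the first division is kept, since it is what later comparisons use. -/
theorem exists_isConstTerm (hX : IsRegularSystem X) (hq : 0 < q) {h : Loc k}
    (hh : h - X 2 ^ q ∈ maxIdeal k ^ (q + 1)) (f : Loc k) :
    ∃ (P : Polynomial (MvPowerSeries (Fin 2) k)) (Q : Loc k), P.natDegree < q ∧
      IsConstTerm q X h f (hX.coord (zPoly P)) ∧ f = hX.coord (zPoly P) + h * Q := by
  have hH : hX.coord.symm h - MvPowerSeries.X 2 ^ q ∈ maxIdeal k ^ (q + 1) := by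
    rw [← map_mem_maxIdeal_pow_iff hX.coord]
    simpa using hh
  have hdiv : ∀ f : Loc k, ∃ (P : Polynomial (MvPowerSeries (Fin 2) k)) (Q : Loc k),
      P.natDegree < q ∧ f = hX.coord (zPoly P) + h * Q := by
    intro f
    obtain ⟨P, Q, hP, hf⟩ := exists_weierstrass_division hq hH (hX.coord.symm f)
    refine ⟨P, hX.coord Q, hP, ?_⟩
    simpa using congrArg hX.coord hf
  choose P Q hP hPQ using hdiv
  have hm : h ∈ maxIdeal k := by
    have h1 := Ideal.pow_le_self (Nat.succ_ne_zero q) hh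
    have h2 := Ideal.pow_mem_of_mem _ (hX.mem 2) q hq
    simpa using Ideal.add_mem _ h1 h2
  have hiter : ∀ N, f = ∑ b ∈ Finset.range N, hX.coord (zPoly (P (Q^[b] f))) * h ^ b +
      h ^ N * Q^[N] f := by
    intro N
    induction N with
    | zero => simp
    | succ N ih =>
      rw [Finset.sum_range_succ, Function.iterate_succ_apply']
      conv_lhs => rw [ih, hPQ (Q^[N] f)]
      ring
  refine ⟨P f, Q f, hP f, ⟨fun b => hX.coord (zPoly (P (Q^[b] f))), ⟨fun b => ?_, fun n => ?_⟩,
    rfl⟩, hPQ f⟩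
  · exact (exists_sum_plane_iff hX hq _).2 ⟨_, hP _, rfl⟩
  · refine ⟨n, fun N hN => ?_⟩
    conv => enter [2, 1]; rw [hiter N]
    rw [add_sub_cancel_left]
    exact Ideal.mul_mem_right _ _ (Ideal.pow_le_pow_right hN (Ideal.pow_mem_pow hm N))

end expansion

/-! ### Hasse derivatives -/

theorem coeff_hasseZ (n : ℕ) (F : Loc k) (d : Fin 3 →₀ ℕ) :
    MvPowerSeries.coeff d (hasseZ n F) =
      (Nat.choose (d 2 + n) n : k) * MvPowerSeries.coeff (d + Finsupp.single 2 n) F := rfl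

theorem hasseZ_sub (n : ℕ) (F G : Loc k) : hasseZ n (F - G) = hasseZ n F - hasseZ n G := by
  ext d
  simp only [coeff_hasseZ, map_sub, mul_sub]

theorem hasseZ_mem {n N : ℕ} {F : Loc k} (hF : F ∈ maxIdeal k ^ N) :
    hasseZ n F ∈ maxIdeal k ^ (N - n) := by
  rw [MvPowerSeries.mem_maximalIdeal_pow_iff_coeff] at hF ⊢
  intro d hd
  rw [coeff_hasseZ, hF, mul_zero]
  rw [map_add, Finsupp.degree_single]
  omega

theorem hasseZ_zPoly (n : ℕ) (P : Polynomial (MvPowerSeries (Fin 2) k)) :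
    hasseZ n (zPoly P) = zPoly (Polynomial.hasseDeriv n P) := by
  ext d
  have h : planeExp (d + Finsupp.single 2 n) = planeExp d := by
    ext i
    fin_cases i <;> simp [planeExp]
  rw [coeff_hasseZ, coeff_zPoly, coeff_zPoly, Polynomial.hasseDeriv_coeff, h, Finsupp.add_apply,
    Finsupp.single_eq_same, ← nsmul_eq_mul, ← nsmul_eq_mul, map_nsmul]

/-- Taylor coefficients are values of Hasse derivatives, and Hasse derivatives commute by the
symmetry of binomial coefficients. -/
theorem hasseDeriv_taylor {A : Type*} [CommRing A] (n : ℕ) (r : A) (P : Polynomial A) :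
    Polynomial.hasseDeriv n (Polynomial.taylor r P) =
      Polynomial.taylor r (Polynomial.hasseDeriv n P) := by
  ext m
  rw [Polynomial.hasseDeriv_coeff, Polynomial.taylor_coeff, Polynomial.taylor_coeff,
    ← LinearMap.comp_apply (Polynomial.hasseDeriv m), Polynomial.hasseDeriv_comp]
  rw [LinearMap.smul_apply, Polynomial.eval_smul, nsmul_eq_mul, ← Nat.choose_symm_add]

/-! ### Orders at the three places -/

theorem weight_apply_fin_two (w : Fin 2 → ℕ) (d : Fin 2 →₀ ℕ) :
    Finsupp.weight w d = d 0 * w 0 + d 1 * w 1 := by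
  rw [Finsupp.weight_apply, Finsupp.sum_fintype _ _ (by simp), Fin.sum_univ_two]
  simp

theorem le_weightedOrder_iff {w : Fin 2 → ℕ} {F : MvPowerSeries (Fin 2) k} {n : ℕ} :
    (n : ℕ∞) ≤ F.weightedOrder w ↔
      ∀ d, Finsupp.weight w d < n → MvPowerSeries.coeff d F = 0 :=
  ⟨fun h _ hd => MvPowerSeries.coeff_eq_zero_of_lt_weightedOrder w
    (lt_of_lt_of_le (by exact_mod_cast hd) h), MvPowerSeries.nat_le_weightedOrder w⟩

/-- The ideal of a place in `k[[X, Y]]`. -/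
def Place.planeIdeal : Place → Ideal (MvPowerSeries (Fin 2) k)
  | .P => IsLocalRing.maximalIdeal _
  | .xiX => Ideal.span {MvPowerSeries.X 0}
  | .xiY => Ideal.span {MvPowerSeries.X 1}

/-- This identification lets the three places be treated uniformly through a weight. -/
theorem Place.mem_planeIdeal_pow_iff (pt : Place) {F : MvPowerSeries (Fin 2) k} {n : ℕ} :
    F ∈ pt.planeIdeal ^ n ↔ (n : ℕ∞) ≤ F.weightedOrder pt.weight := by
  cases pt with
  | P =>
    have : Place.P.weight = fun _ => 1 := by
      funext i
      fin_cases i <;> rfl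
    rw [this]
    exact MvPowerSeries.mem_maximalIdeal_pow_iff
  | xiX =>
    rw [le_weightedOrder_iff, planeIdeal, Ideal.span_singleton_pow, Ideal.mem_span_singleton,
      MvPowerSeries.X_pow_dvd_iff]
    simp [weight_apply_fin_two, Place.weight]
  | xiY =>
    rw [le_weightedOrder_iff, planeIdeal, Ideal.span_singleton_pow, Ideal.mem_span_singleton,
      MvPowerSeries.X_pow_dvd_iff]
    simp [weight_apply_fin_two, Place.weight]

theorem le_ordAt_iff {J : Ideal (Loc k)} {f : Loc k} {n : ℕ} :
    (n : ℕ∞) ≤ ordAt J f ↔ f ∈ J ^ n := by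
  constructor
  · intro h
    cases n with
    | zero => simp
    | succ n =>
      have h1 : (n : ℕ∞) < ordAt J f := lt_of_lt_of_le (by exact_mod_cast Nat.lt_succ_self n) h
      simp only [ordAt, lt_iSup_iff] at h1
      obtain ⟨m, hm, hnm⟩ := h1
      exact Ideal.pow_le_pow_right (by exact_mod_cast hnm) hm
  · intro h
    exact le_iSup₂ (f := fun (m : ℕ) (_ : m ∈ {n : ℕ | f ∈ J ^ n}) => (m : ℕ∞)) n h

section regular

variable {X : Fin 3 → Loc k}

/-- Restriction to a graph `z = φ(x, y)` cannot lower the order: the generators of the place's ideal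
restrict into the corresponding ideal of `k[[X, Y]]`. -/
theorem evalZ_coord_symm_mem (hX : IsRegularSystem X) (pt : Place) {φ : MvPowerSeries (Fin 2) k}
    (hφ : φ ∈ IsLocalRing.maximalIdeal (MvPowerSeries (Fin 2) k)) {f : Loc k} {n : ℕ}
    (hf : f ∈ pt.ideal X ^ n) : evalZ φ hφ (hX.coord.symm f) ∈ pt.planeIdeal ^ n := by
  have h := Ideal.mem_map_of_mem ((evalZ φ hφ).comp hX.coord.symm.toAlgHom) hf
  rw [Ideal.map_pow] at h
  refine Ideal.pow_right_mono ?_ n h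
  have hx : ∀ i, ((evalZ φ hφ).comp hX.coord.symm.toAlgHom) (X i) =
      ![MvPowerSeries.X 0, MvPowerSeries.X 1, φ] i := fun i => by
    change evalZ φ hφ (hX.coord.symm (X i)) = _
    rw [hX.coord_symm, evalZ_X]
  cases pt with
  | P =>
    rw [Place.ideal, ← (hX : Ideal.span (Set.range X) = maxIdeal k), Ideal.map_span, Ideal.span_le]
    rintro _ ⟨_, ⟨i, rfl⟩, rfl⟩
    rw [hx]
    fin_cases i
    · exact MvPowerSeries.mem_maximalIdeal_iff.2 (by simp)
    · exact MvPowerSeries.mem_maximalIdeal_iff.2 (by simp)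
    · exact hφ
  | xiX =>
    rw [Place.ideal, Ideal.map_span, Set.image_singleton, hx]
    exact le_rfl
  | xiY =>
    rw [Place.ideal, Ideal.map_span, Set.image_singleton, hx]
    exact le_rfl

theorem plane_mem_pow (hX : IsRegularSystem X) (pt : Place) {F : MvPowerSeries (Fin 2) k} {n : ℕ}
    (hF : F ∈ pt.planeIdeal ^ n) : plane X F ∈ pt.ideal X ^ n := by
  have h := Ideal.mem_map_of_mem (hX.coord.toAlgHom.comp planeEmb) hF
  rw [Ideal.map_pow] at h
  rw [hX.plane_eq]
  refine Ideal.pow_right_mono ?_ n h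
  have hx : ∀ i, (hX.coord.toAlgHom.comp planeEmb) (MvPowerSeries.X i) = X i.castSucc := fun i => by
    change hX.coord (planeEmb (MvPowerSeries.X i)) = _
    rw [planeEmb_X, hX.coord_X]
  cases pt with
  | P =>
    rw [Place.planeIdeal, MvPowerSeries.maximalIdeal_eq_span_X, Ideal.map_span, Ideal.span_le]
    rintro _ ⟨_, ⟨i, rfl⟩, rfl⟩
    rw [hx]
    exact hX.mem _
  | xiX =>
    rw [Place.planeIdeal, Ideal.map_span, Set.image_singleton, hx]
    exact le_rfl
  | xiY =>
    rw [Place.planeIdeal, Ideal.map_span, Set.image_singleton, hx]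
    exact le_rfl

theorem ordAt_le_weightedOrder (hX : IsRegularSystem X) (pt : Place) {φ : MvPowerSeries (Fin 2) k}
    (hφ : φ ∈ IsLocalRing.maximalIdeal (MvPowerSeries (Fin 2) k)) (f : Loc k) :
    ordAt (pt.ideal X) f ≤ (evalZ φ hφ (hX.coord.symm f)).weightedOrder pt.weight := by
  refine ENat.forall_natCast_le_iff_le.1 fun n hn => ?_
  exact pt.mem_planeIdeal_pow_iff.1 (evalZ_coord_symm_mem hX pt hφ (le_ordAt_iff.1 hn))

theorem ordAt_plane (hX : IsRegularSystem X) (pt : Place) (F : MvPowerSeries (Fin 2) k) :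
    ordAt (pt.ideal X) (plane X F) = F.weightedOrder pt.weight := by
  refine le_antisymm ?_ (ENat.forall_natCast_le_iff_le.1 fun n hn => ?_)
  · have := ordAt_le_weightedOrder hX pt (Ideal.zero_mem _) (plane X F)
    rwa [hX.plane_eq, AlgEquiv.symm_apply_apply, evalZ_planeEmb, ← hX.plane_eq] at this
  · exact le_ordAt_iff.2 (plane_mem_pow hX pt (pt.mem_planeIdeal_pow_iff.2 hn))

theorem mem_ideal_pow_of_dvd (hX : IsRegularSystem X) (pt : Place) {A B : ℕ} {f : Loc k}
    (h : X 0 ^ A * X 1 ^ B ∣ f) : f ∈ pt.ideal X ^ (A * pt.weight 0 + B * pt.weight 1) := by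
  refine Ideal.mem_of_dvd _ h ?_
  cases pt with
  | P =>
    simp only [Place.weight, Matrix.cons_val_zero, Matrix.cons_val_one, mul_one, pow_add]
    exact Ideal.mul_mem_mul (Ideal.pow_mem_pow (hX.mem 0) A) (Ideal.pow_mem_pow (hX.mem 1) B)
  | xiX =>
    simp only [Place.weight, Matrix.cons_val_zero, Matrix.cons_val_one, mul_one, mul_zero, add_zero]
    exact Ideal.mul_mem_right _ _ (Ideal.pow_mem_pow (Ideal.mem_span_singleton_self _) A)
  | xiY =>
    simp only [Place.weight, Matrix.cons_val_zero, Matrix.cons_val_one, mul_one, mul_zero, zero_add]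
    exact Ideal.mul_mem_left _ _ (Ideal.pow_mem_pow (Ideal.mem_span_singleton_self _) B)

end regular

theorem coeff_X_pow_mul_X_pow (A B : ℕ) (d : Fin 2 →₀ ℕ) :
    MvPowerSeries.coeff d (MvPowerSeries.X 0 ^ A * MvPowerSeries.X 1 ^ B :
      MvPowerSeries (Fin 2) k) = if d 0 = A ∧ d 1 = B then 1 else 0 := by
  classical
  rw [MvPowerSeries.X_pow_eq, MvPowerSeries.X_pow_eq, MvPowerSeries.monomial_mul_monomial,
    MvPowerSeries.coeff_monomial, mul_one]
  congr 1
  rw [Finsupp.ext_iff, Fin.forall_fin_two]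
  simp

theorem weightedOrder_X_pow_mul_X_pow (w : Fin 2 → ℕ) (A B : ℕ) :
    (MvPowerSeries.X 0 ^ A * MvPowerSeries.X 1 ^ B : MvPowerSeries (Fin 2) k).weightedOrder w =
      ((A * w 0 + B * w 1 : ℕ) : ℕ∞) := by
  rw [MvPowerSeries.X_pow_eq, MvPowerSeries.X_pow_eq, MvPowerSeries.monomial_mul_monomial, mul_one,
    MvPowerSeries.weightedOrder_monomial_of_ne_zero _ one_ne_zero, weight_apply_fin_two]
  simp

theorem natCast_div_le_div_iff {N a n l : ℕ} (ha : 0 < a) (hl : 0 < l) :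
    (N : ℝ≥0∞) / a ≤ (n : ℝ≥0∞) / l ↔ N * l ≤ n * a := by
  rw [ENNReal.div_le_iff (by exact_mod_cast ha.ne') (ENNReal.natCast_ne_top a),
    ← ENNReal.mul_div_right_comm,
    ENNReal.le_div_iff_mul_le (Or.inl (by exact_mod_cast hl.ne'))
      (Or.inl (ENNReal.natCast_ne_top l))]
  exact_mod_cast Iff.rfl

/-! ### The defining polynomial of `h` -/

/-- The polynomial `T ^ q + a₁ T ^ (q - 1) + ⋯ + a_q` over `k[[X, Y]]`. -/
def Choice.poly (D : Choice k) (q : ℕ) : Polynomial (MvPowerSeries (Fin 2) k) :=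
  Polynomial.X ^ q + ∑ i ∈ Finset.Icc 1 q, Polynomial.monomial (q - i) (D.a i)

theorem Choice.natDegree_poly_le (D : Choice k) (q : ℕ) : (D.poly q).natDegree ≤ q := by
  refine Polynomial.natDegree_add_le_of_degree_le (Polynomial.natDegree_X_pow_le q)
    (Polynomial.natDegree_sum_le_of_forall_le _ _ fun i _ => ?_)
  exact (Polynomial.natDegree_monomial_le _).trans (Nat.sub_le q i)

theorem Choice.coeff_poly_sub (D : Choice k) {q i : ℕ} (hi : i ∈ Finset.Icc 1 q) :
    (D.poly q).coeff (q - i) = D.a i := by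
  have hi' := Finset.mem_Icc.1 hi
  rw [poly, Polynomial.coeff_add, Polynomial.coeff_X_pow, if_neg (by omega), zero_add,
    Polynomial.finsetSum_coeff, Finset.sum_eq_single i]
  · rw [Polynomial.coeff_monomial, if_pos rfl]
  · intro j hj hji
    have hj' := Finset.mem_Icc.1 hj
    rw [Polynomial.coeff_monomial, if_neg (by omega)]
  · intro h
    exact absurd hi h

theorem Choice.eval_poly (D : Choice k) {q : ℕ} (hq : 0 < q) (φ : MvPowerSeries (Fin 2) k) :
    (D.poly q).eval φ = φ ^ q + ∑ i ∈ Finset.Ico 1 q, D.a i * φ ^ (q - i) + D.a q := by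
  rw [poly, Polynomial.eval_add, Polynomial.eval_X_pow, Polynomial.eval_finsetSum,
    ← Finset.Ico_insert_right (show 1 ≤ q from hq), Finset.sum_insert (by simp)]
  simp only [Polynomial.eval_monomial, Nat.sub_self, pow_zero, mul_one]
  ring

variable {R : IdealisticFiltration k} {B : Boundary k} {q : ℕ} {D : Choice k}

theorem Choice.coord_zPoly_poly (D : Choice k) (q : ℕ) (hX : IsRegularSystem D.X) :
    hX.coord (zPoly (D.poly q)) =
      D.X 2 ^ q + ∑ i ∈ Finset.Icc 1 q, plane D.X (D.a i) * D.X 2 ^ (q - i) := by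
  rw [Choice.poly, map_add, map_add, map_sum, map_sum, map_pow, map_pow, zPoly_X, hX.coord_X]
  congr 1
  refine Finset.sum_congr rfl fun i _ => ?_
  rw [zPoly_monomial, map_mul, map_pow, hX.coord_X, hX.plane_eq]

theorem Situation.h_eq (S : Situation R B q D) (hX : IsRegularSystem D.X) :
    D.h = hX.coord (zPoly (D.poly q)) := by
  rw [S.weierstrass, D.coord_zPoly_poly]

/-- The `(q - i)`-th derivative of `h` has level `i`, is its own constant term, and specialises
to `a i` for `z = 0`. -/
theorem Situation.exists_isConstTerm_coeff (S : Situation R B q D) {i : ℕ}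
    (hi : i ∈ Finset.Ico 1 q) : ∃ f : Loc k, f ∈ R.I i ∧ IsConstTerm q D.X D.h f f ∧
      evalZ 0 (Ideal.zero_mem _) (S.lgs.regular.coord.symm f) = D.a i := by
  have hi' := Finset.mem_Ico.1 hi
  refine ⟨S.lgs.regular.coord (zPoly (Polynomial.hasseDeriv (q - i) (D.poly q))), ?_, ?_, ?_⟩
  · have := S.saturated q (q - i) (zPoly (D.poly q))
      (by rw [← S.lgs.regular.coord_apply, ← S.h_eq S.lgs.regular]; exact S.lgs.mem)
    rwa [hasseZ_zPoly, ← S.lgs.regular.coord_apply, Nat.sub_sub_self hi'.2.le] at this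
  · refine isConstTerm_self _ (by omega) _ ?_
    have h1 := Polynomial.natDegree_hasseDeriv_le (D.poly q) (q - i)
    have h2 := D.natDegree_poly_le q
    omega
  · rw [AlgEquiv.symm_apply_apply, evalZ_zPoly, ← Polynomial.coeff_zero_eq_eval_zero,
      Polynomial.hasseDeriv_coeff, zero_add, Nat.choose_self, Nat.cast_one, one_mul,
      D.coeff_poly_sub (Finset.mem_Icc.2 ⟨hi'.1, hi'.2.le⟩)]

/-- The derivative of `h` that specialises to `a i` competes in the infimum, and setting `z = 0` can
only raise its order. -/
theorem Situation.mu_le_weightedOrder_coeff (S : Situation R B q D) (pt : Place) {i : ℕ}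
    (hi : i ∈ Finset.Ico 1 q) :
    mu R q D pt ≤ ((D.a i).weightedOrder pt.weight : ℝ≥0∞) / (i : ℝ≥0∞) := by
  obtain ⟨f, hf, hc, hfi⟩ := S.exists_isConstTerm_coeff hi
  have h1 : mu R q D pt ≤ (ordAt (pt.ideal D.X) f : ℝ≥0∞) / (i : ℝ≥0∞) :=
    sInf_le ⟨i, f, f, (Finset.mem_Ico.1 hi).1, hf, hc, rfl⟩
  have h2 := ordAt_le_weightedOrder S.lgs.regular pt (Ideal.zero_mem _) f
  rw [hfi] at h2
  exact h1.trans (ENNReal.div_le_div_right (by exact_mod_cast h2) _)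

/-- The data of the monomial condition. -/
structure IsMonomialDatum (R : IdealisticFiltration k) (B : Boundary k) (q : ℕ)
    (X : Fin 3 → Loc k) (h : Loc k) (α β a : ℕ) : Prop where
  pos : 0 < a
  exp_eq_zero : B.Hy = none → β = 0
  mem : X 0 ^ α * X 1 ^ β ∈ R.I a
  dvd : ∀ (lam : ℕ) (f c₀ : Loc k), f ∈ R.I lam → IsConstTerm q X h f c₀ →
    X 0 ^ ⌈((α : ℚ) * lam) / a⌉₊ * X 1 ^ ⌈((β : ℚ) * lam) / a⌉₊ ∣ c₀

theorem monomialCondition_iff {X : Fin 3 → Loc k} {h : Loc k} :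
    MonomialCondition R B q X h ↔ ∃ α β a, IsMonomialDatum R B q X h α β a :=
  ⟨fun ⟨α, β, a, h1, h2, h3, h4⟩ => ⟨α, β, a, h1, h2, h3, h4⟩,
    fun ⟨α, β, a, h⟩ => ⟨α, β, a, h.1, h.2, h.3, h.4⟩⟩

theorem mul_le_mul_ceil {α lam a : ℕ} (ha : 0 < a) : α * lam ≤ ⌈((α : ℚ) * lam) / a⌉₊ * a := by
  have h := Nat.le_ceil (((α : ℚ) * lam) / a)
  rw [div_le_iff₀ (by exact_mod_cast ha)] at h
  exact_mod_cast h

theorem mul_le_mul_of_ceil_le {α lam a n : ℕ} (ha : 0 < a) (h : ⌈((α : ℚ) * lam) / a⌉₊ ≤ n) :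
    α * lam ≤ n * a :=
  (mul_le_mul_ceil ha).trans (Nat.mul_le_mul_right a h)

theorem plane_X_pow_mul_X_pow {X : Fin 3 → Loc k} (hX : IsRegularSystem X) (α β : ℕ) :
    plane X (MvPowerSeries.X 0 ^ α * MvPowerSeries.X 1 ^ β) = X 0 ^ α * X 1 ^ β := by
  rw [hX.plane_eq, map_mul, map_mul, map_pow, map_pow, map_pow, map_pow, planeEmb_X, planeEmb_X,
    hX.coord_X, hX.coord_X]
  rfl

/-- The monomial is its own constant term and attains the infimum; divisibility of the other
constant terms gives the lower bound. -/
theorem IsMonomialDatum.mu_eq {α β a : ℕ} (M : IsMonomialDatum R B q D.X D.h α β a)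
    (hX : IsRegularSystem D.X) (hq : 0 < q) (pt : Place) :
    mu R q D pt = ((α * pt.weight 0 + β * pt.weight 1 : ℕ) : ℝ≥0∞) / (a : ℝ≥0∞) := by
  refine le_antisymm (sInf_le ⟨a, _, D.X 0 ^ α * D.X 1 ^ β, M.pos, M.mem, ?_, ?_⟩) (le_sInf ?_)
  · rw [← plane_X_pow_mul_X_pow hX]
    exact isConstTerm_plane hX hq _ _
  · rw [← plane_X_pow_mul_X_pow hX, ordAt_plane hX, weightedOrder_X_pow_mul_X_pow]
    simp
  · rintro s ⟨lam, f, c₀, hlam, hf, hc, rfl⟩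
    have h1 := le_ordAt_iff.2 (mem_ideal_pow_of_dvd hX pt (M.dvd lam f c₀ hf hc))
    refine le_trans ?_ (ENNReal.div_le_div_right (ENat.toENNReal_le.2 h1) _)
    rw [ENat.toENNReal_coe, natCast_div_le_div_iff M.pos hlam]
    have hα := mul_le_mul_ceil (α := α) (lam := lam) M.pos
    have hβ := mul_le_mul_ceil (α := β) (lam := lam) M.pos
    calc (α * pt.weight 0 + β * pt.weight 1) * lam
        = α * lam * pt.weight 0 + β * lam * pt.weight 1 := by ring
      _ ≤ ⌈((α : ℚ) * lam) / a⌉₊ * a * pt.weight 0 + ⌈((β : ℚ) * lam) / a⌉₊ * a * pt.weight 1 :=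
        Nat.add_le_add (Nat.mul_le_mul_right _ hα) (Nat.mul_le_mul_right _ hβ)
      _ = _ := by ring

/-- The divisibility of the coefficients of `h` by the monomial. -/
theorem IsMonomialDatum.dvd_coeff {α β a : ℕ} (M : IsMonomialDatum R B q D.X D.h α β a)
    (S : Situation R B q D) {i : ℕ} (hi : i ∈ Finset.Ico 1 q) :
    (MvPowerSeries.X 0 ^ ⌈((α : ℚ) * i) / a⌉₊ * MvPowerSeries.X 1 ^ ⌈((β : ℚ) * i) / a⌉₊ :
      MvPowerSeries (Fin 2) k) ∣ D.a i := by
  obtain ⟨f, hf, hc, hfi⟩ := S.exists_isConstTerm_coeff hi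
  have h := map_dvd (evalZ 0 (Ideal.zero_mem _))
    (map_dvd S.lgs.regular.coord.symm (M.dvd i f f hf hc))
  rw [hfi] at h
  simpa [evalZ_X] using h

theorem Situation.h_mem (S : Situation R B q D) (hq : 0 < q) : D.h ∈ maxIdeal k := by
  have h1 := Ideal.pow_le_self (Nat.succ_ne_zero q) S.lgs.congr
  have h2 := Ideal.pow_mem_of_mem _ (S.lgs.regular.mem 2) q hq
  simpa using Ideal.add_mem _ h1 h2

/-- The ratios `α / a` and `β / a` do not depend on the choices. -/
theorem IsMonomialDatum.mul_le_mul {D' : Choice k} {α β a α' β' a' : ℕ}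
    (M : IsMonomialDatum R B q D.X D.h α β a) (M' : IsMonomialDatum R B q D'.X D'.h α' β' a')
    (S : Situation R B q D) (S' : Situation R B q D') (hq : 0 < q) :
    α' * a ≤ α * a' ∧ β' * a ≤ β * a' := by
  have : IsDomain (Loc k) := NoZeroDivisors.to_isDomain _
  have hx : Associated (D'.X 0) (D.X 0) :=
    Ideal.span_singleton_eq_span_singleton.1 (S'.eq_x.trans S.eq_x.symm)
  -- Without a second component `y` is not determined by the boundary, but then `β = 0`.
  have hy : Associated (D'.X 1 ^ β) (D.X 1 ^ β) := by
    rcases hB : B.Hy with _ | J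
    · rw [M.exp_eq_zero hB, pow_zero, pow_zero]
    · exact (Ideal.span_singleton_eq_span_singleton.1
        ((S'.eq_y J (by simp [hB])).trans (S.eq_y J (by simp [hB])).symm)).pow_pow
  obtain ⟨W, hW⟩ := (hx.pow_pow (n := α)).mul_mul hy
  have hX' := S'.lgs.regular
  -- The two monomials with exponents `α, β` differ by the unit `W`. Its constant term with respect
  -- to the second pair is again a unit, because `h` is not, so the second monomial condition bounds
  -- `α` and `β` from below.
  obtain ⟨P, Q, -, hc, hPQ⟩ := exists_isConstTerm hX' hq S'.lgs.congr (W : Loc k)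
  have hunit : IsUnit (hX'.coord (zPoly P)) := by
    by_contra hn
    have h1 : (W : Loc k) ∈ maxIdeal k := by
      rw [hPQ]
      exact Ideal.add_mem _ ((IsLocalRing.mem_maximalIdeal _).2 hn)
        (Ideal.mul_mem_right _ _ (S'.h_mem hq))
    exact (IsLocalRing.mem_maximalIdeal _).1 h1 W.isUnit
  have hd := M'.dvd a _ _ M.mem (by
    rw [← hW, ← plane_X_pow_mul_X_pow hX']
    exact hc.plane_mul hX' _)
  rw [IsUnit.dvd_mul_right hunit] at hd
  have hd' := map_dvd (evalZ 0 (Ideal.zero_mem _)) (map_dvd hX'.coord.symm hd)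
  rw [plane_X_pow_mul_X_pow hX'] at hd'
  simp only [map_mul, map_pow, hX'.coord_symm, evalZ_X, Matrix.cons_val_zero,
    Matrix.cons_val_one] at hd'
  have hco := coeff_X_pow_mul_X_pow (k := k) α β (Finsupp.single 0 α + Finsupp.single 1 β)
  have h0 := MvPowerSeries.X_pow_dvd_iff.1 ((Dvd.intro _ rfl).trans hd')
    (Finsupp.single 0 α + Finsupp.single 1 β)
  have h1 := MvPowerSeries.X_pow_dvd_iff.1 ((Dvd.intro_left _ rfl).trans hd')
    (Finsupp.single 0 α + Finsupp.single 1 β)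
  simp only [hco] at h0 h1
  simp at h0 h1
  constructor
  · refine mul_le_mul_of_ceil_le M'.pos (Nat.ceil_le.2 h0)
  · refine mul_le_mul_of_ceil_le M'.pos (Nat.ceil_le.2 h1)

theorem eq_top_or_exists_eq_natCast (o : ℕ∞) : o = ⊤ ∨ ∃ n : ℕ, o = n := by
  induction o using ENat.recTopCoe with
  | top => exact Or.inl rfl
  | coe n => exact Or.inr ⟨n, rfl⟩

/-! ### Powers of exponent a power of the characteristic -/

section frobenius

variable {σ : Type*} (p e : ℕ) [ExpChar k p]

theorem expChar_mvPowerSeries : ExpChar (MvPowerSeries σ k) p :=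
  expChar_of_injective_algebraMap (algebraMap k (MvPowerSeries σ k)).injective p

theorem coeff_smul_pow_expChar_pow (F : MvPowerSeries σ k) (d : σ →₀ ℕ) :
    MvPowerSeries.coeff (p ^ e • d) (F ^ p ^ e) = MvPowerSeries.coeff d F ^ p ^ e := by
  rw [← MvPowerSeries.map_iterateFrobenius_expand p (expChar_ne_zero k p),
    MvPowerSeries.coeff_map, MvPowerSeries.coeff_expand_smul, iterateFrobenius_def]

theorem exists_eq_smul_of_coeff_pow_expChar_pow_ne_zero {F : MvPowerSeries σ k} {d : σ →₀ ℕ}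
    (h : MvPowerSeries.coeff d (F ^ p ^ e) ≠ 0) : ∃ d', d = p ^ e • d' := by
  have hdvd : ∀ i, p ^ e ∣ d i := by
    intro i
    by_contra hi
    rw [← MvPowerSeries.map_iterateFrobenius_expand p (expChar_ne_zero k p),
      MvPowerSeries.coeff_map, MvPowerSeries.coeff_expand_of_not_dvd _ _ _ hi, map_zero] at h
    exact h rfl
  refine ⟨d.mapRange (· / p ^ e) (Nat.zero_div _), ?_⟩
  ext i
  simp [Nat.mul_div_cancel' (hdvd i)]

/-- Frobenius acts monomial by monomial, so the component of weight `N` is the power of the part of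
`F` whose weight times `p ^ e` is `N`. -/
theorem exists_pow_eq_weightedHomogeneousComponent (w : σ → ℕ) (N : ℕ) (F : MvPowerSeries σ k) :
    ∃ G : MvPowerSeries σ k,
      G ^ p ^ e = MvPowerSeries.weightedHomogeneousComponent w N (F ^ p ^ e) := by
  classical
  have hq : p ^ e ≠ 0 := (expChar_pow_pos k p e).ne'
  refine ⟨MvPowerSeries.ofCoeff fun d => if p ^ e * Finsupp.weight w d = N then
    MvPowerSeries.coeff d F else 0, ?_⟩
  ext d
  rw [MvPowerSeries.coeff_weightedHomogeneousComponent]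
  by_cases hd : ∃ d', d = p ^ e • d'
  · obtain ⟨d', rfl⟩ := hd
    rw [coeff_smul_pow_expChar_pow, coeff_smul_pow_expChar_pow, MvPowerSeries.coeff_ofCoeff,
      map_nsmul, smul_eq_mul]
    split_ifs
    · rfl
    · exact zero_pow hq
  · rw [not_imp_comm.1 (exists_eq_smul_of_coeff_pow_expChar_pow_ne_zero p e) hd,
      not_imp_comm.1 (exists_eq_smul_of_coeff_pow_expChar_pow_ne_zero p e) hd, ite_self]

end frobenius

/-! ### The initial form of the last coefficient -/

/-- With `ord A > iN/q` and `ord φ ≥ L/q`, where `L ≤ N`, the total exceeds `iL/q + (q-i)L/q = L`;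
strictness comes from `A` alone. -/
theorem lt_weightedOrder_mul_pow {w : Fin 2 → ℕ} {A φ : MvPowerSeries (Fin 2) k}
    {q i N b t L : ℕ} (hi : i ∈ Finset.Ico 1 q) (hb : i * N < q * b)
    (hbA : (b : ℕ∞) ≤ A.weightedOrder w) (ht : (t : ℕ∞) ≤ φ.weightedOrder w) (hLN : L ≤ N)
    (hLt : L ≤ q * t) : ((L + 1 : ℕ) : ℕ∞) ≤ (A * φ ^ (q - i)).weightedOrder w := by
  have hi' := Finset.mem_Ico.1 hi
  have h1 : ((b + (q - i) * t : ℕ) : ℕ∞) ≤ (A * φ ^ (q - i)).weightedOrder w := by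
    refine le_trans ?_ (MvPowerSeries.le_weightedOrder_mul w)
    push_cast
    refine add_le_add hbA (le_trans ?_ (MvPowerSeries.le_weightedOrder_pow w _))
    rw [nsmul_eq_mul]
    exact mul_le_mul_right ht _
  refine le_trans ?_ h1
  have h2 : q * L < q * (b + (q - i) * t) := by
    obtain ⟨j, rfl⟩ := Nat.exists_eq_add_of_le hi'.2.le
    rw [Nat.add_sub_cancel_left]
    calc (i + j) * L = i * L + j * L := by ring
      _ ≤ i * N + j * ((i + j) * t) :=
        Nat.add_le_add (Nat.mul_le_mul_left _ hLN) (Nat.mul_le_mul_left _ hLt)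
      _ < (i + j) * b + j * ((i + j) * t) := Nat.add_lt_add_right hb _
      _ = (i + j) * (b + j * t) := by ring
  exact_mod_cast Nat.lt_of_mul_lt_mul_left h2

theorem le_weightedOrder_sum {ι : Type*} {w : Fin 2 → ℕ} {n : ℕ∞} (s : Finset ι)
    (F : ι → MvPowerSeries (Fin 2) k) (h : ∀ i ∈ s, n ≤ (F i).weightedOrder w) :
    n ≤ (∑ i ∈ s, F i).weightedOrder w := by
  classical
  induction s using Finset.induction_on with
  | empty => simp
  | insert i s hi ih =>
    rw [Finset.sum_insert hi]
    exact le_trans (le_min (h i (Finset.mem_insert_self i s))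
      (ih fun j hj => h j (Finset.mem_insert_of_mem hj))) (MvPowerSeries.min_weightedOrder_le_add w)

/-- In `φ^q + ∑ a_i φ^(q-i) + a_q` the mixed terms have order above `N`, so only `φ^q` can cancel
the initial form of `a_q`. -/
theorem exists_pow_eq_initialForm (p e : ℕ) [ExpChar k p] (pt : Place) {D : Choice k} {N : ℕ}
    (hN : (D.a (p ^ e)).weightedOrder pt.weight = N)
    (hcoeff : ∀ i ∈ Finset.Ico 1 (p ^ e), ∃ b : ℕ, i * N < p ^ e * b ∧
      (b : ℕ∞) ≤ (D.a i).weightedOrder pt.weight)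
    {φ : MvPowerSeries (Fin 2) k}
    (hφ : ((N + 1 : ℕ) : ℕ∞) ≤ ((D.poly (p ^ e)).eval φ).weightedOrder pt.weight) :
    ∃ G : MvPowerSeries (Fin 2) k, G ^ p ^ e = initialForm pt (D.a (p ^ e)) := by
  have := expChar_mvPowerSeries (k := k) (σ := Fin 2) p
  have hq : 0 < p ^ e := expChar_pow_pos k p e
  rw [D.eval_poly hq] at hφ
  have hsum : ∀ {t L : ℕ}, (t : ℕ∞) ≤ φ.weightedOrder pt.weight → L ≤ N → L ≤ p ^ e * t →
      ((L + 1 : ℕ) : ℕ∞) ≤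
        (∑ i ∈ Finset.Ico 1 (p ^ e), D.a i * φ ^ (p ^ e - i)).weightedOrder pt.weight := by
    intro t L ht hLN hLt
    refine le_weightedOrder_sum _ _ fun i hi => ?_
    obtain ⟨b, hb, hbA⟩ := hcoeff i hi
    exact lt_weightedOrder_mul_pow hi hb hbA ht hLN hLt
  -- First `ord φ ≥ N/q`: otherwise `φ^q` would have order strictly below every other term, and
  -- nothing could cancel it. For `φ` of infinite order any large `t` works, for instance `N`.
  have ht : ∃ t : ℕ, (t : ℕ∞) ≤ φ.weightedOrder pt.weight ∧ N ≤ p ^ e * t := by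
    rcases eq_top_or_exists_eq_natCast (φ.weightedOrder pt.weight) with h | ⟨t, h⟩
    · exact ⟨N, h ▸ le_top, Nat.le_mul_of_pos_left N hq⟩
    · refine ⟨t, h.ge, ?_⟩
      by_contra hlt
      push Not at hlt
      have h1 := hsum (t := t) (L := p ^ e * t) h.ge hlt.le le_rfl
      have h2 : (φ ^ p ^ e).weightedOrder pt.weight = ((p ^ e * t : ℕ) : ℕ∞) := by
        have := MvPowerSeries.weightedOrder_prod pt.weight (fun _ : ℕ => φ) (Finset.range (p ^ e))
        rw [Finset.prod_const, Finset.card_range, Finset.sum_const, Finset.card_range] at this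
        rw [this, h, nsmul_eq_mul]
        push_cast
        rfl
      have h3 : ((p ^ e * t + 1 : ℕ) : ℕ∞) ≤ (φ ^ p ^ e).weightedOrder pt.weight := by
        have e1 : φ ^ p ^ e =
            (φ ^ p ^ e + ∑ i ∈ Finset.Ico 1 (p ^ e), D.a i * φ ^ (p ^ e - i) + D.a (p ^ e)) +
              (-(∑ i ∈ Finset.Ico 1 (p ^ e), D.a i * φ ^ (p ^ e - i)) + -D.a (p ^ e)) := by ring
        rw [e1]
        refine le_trans (le_min ?_ (le_trans (le_min ?_ ?_)
          (MvPowerSeries.min_weightedOrder_le_add _))) (MvPowerSeries.min_weightedOrder_le_add _)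
        · exact le_trans (by exact_mod_cast (by omega)) hφ
        · rwa [MvPowerSeries.weightedOrder_neg]
        · rw [MvPowerSeries.weightedOrder_neg, hN]
          exact_mod_cast hlt
      rw [h2] at h3
      have h4 : p ^ e * t + 1 ≤ p ^ e * t := by exact_mod_cast h3
      omega
  obtain ⟨t, ht, hNt⟩ := ht
  have hdiff : ((N + 1 : ℕ) : ℕ∞) ≤ (D.a (p ^ e) - (-φ) ^ p ^ e).weightedOrder pt.weight := by
    have hneg : (-φ) ^ p ^ e = -φ ^ p ^ e := by
      have := sub_pow_expChar_pow (p := p) (0 : MvPowerSeries (Fin 2) k) φ e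
      rwa [zero_pow hq.ne', zero_sub, zero_sub] at this
    have e1 : D.a (p ^ e) - (-φ) ^ p ^ e =
        (φ ^ p ^ e + ∑ i ∈ Finset.Ico 1 (p ^ e), D.a i * φ ^ (p ^ e - i) + D.a (p ^ e)) +
          -(∑ i ∈ Finset.Ico 1 (p ^ e), D.a i * φ ^ (p ^ e - i)) := by
      rw [hneg]
      ring
    rw [e1]
    refine le_trans (le_min hφ ?_) (MvPowerSeries.min_weightedOrder_le_add _)
    rw [MvPowerSeries.weightedOrder_neg]
    exact hsum ht le_rfl hNt
  have hcomp : initialForm pt (D.a (p ^ e)) =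
      MvPowerSeries.weightedHomogeneousComponent pt.weight N ((-φ) ^ p ^ e) := by
    rw [initialForm, hN, ENat.toNat_natCast, ← sub_eq_zero, ← map_sub]
    exact MvPowerSeries.weightedHomogeneousComponent_of_lt_weightedOrder_eq_zero
      (lt_of_lt_of_le (by exact_mod_cast Nat.lt_succ_self N) hdiff)
  rw [hcomp]
  exact exists_pow_eq_weightedHomogeneousComponent p e pt.weight N (-φ)

/-! ### Comparison of two choices -/

section compare

variable {D' : Choice k}

/-- The coefficient of `Z^q` is `-c`, since `P` has degree less than `q` in `Z`. -/
theorem coord_zPoly_sub_smul_notMem (X : Fin 3 → Loc k) (hX : IsRegularSystem X) (q : ℕ)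
    {c : k} (hc : c ≠ 0) (P : Polynomial (MvPowerSeries (Fin 2) k)) (hP : P.natDegree < q) :
    hX.coord (zPoly P) - c • X 2 ^ q ∉ maxIdeal k ^ (q + 1) := by
  classical
  intro h
  rw [← map_mem_maxIdeal_pow_iff hX.coord.symm, map_sub, map_smul, map_pow, hX.coord_symm,
    AlgEquiv.symm_apply_apply, MvPowerSeries.mem_maximalIdeal_pow_iff_coeff] at h
  have h1 := h (Finsupp.single 2 q) (by rw [Finsupp.degree_single]; omega)
  rw [map_sub, coeff_zPoly, Finsupp.single_eq_same, Polynomial.coeff_eq_zero_of_natDegree_lt hP,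
    map_zero, map_smul, MvPowerSeries.coeff_X_pow, if_pos rfl] at h1
  simp [hc] at h1

/-- The degree `q` part of the leading algebra is the same line, spanned by either leading form. -/
theorem Situation.exists_smul_sub_mem (S : Situation R B q D) (S' : Situation R B q D')
    (hq : 0 < q) : ∃ c : k, c ≠ 0 ∧ D'.X 2 ^ q - c • D.X 2 ^ q ∈ maxIdeal k ^ (q + 1) := by
  have h1 : D'.X 2 ^ q ∈ R.leadingPart q := by
    rw [S'.lgs.leading q]
    exact Submodule.mem_sup_left (Submodule.subset_span ⟨dvd_rfl, rfl⟩)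
  rw [S.lgs.leading q] at h1
  obtain ⟨u, hu, v, hv, huv⟩ := Submodule.mem_sup.1 h1
  have hset : {f | q ∣ q ∧ f = D.X 2 ^ q} = {D.X 2 ^ q} := by
    ext f
    simp
  rw [hset, Submodule.mem_span_singleton] at hu
  obtain ⟨c, rfl⟩ := hu
  refine ⟨c, ?_, ?_⟩
  · rintro rfl
    rw [zero_smul, zero_add] at huv
    rw [Submodule.restrictScalars_mem, huv] at hv
    refine coord_zPoly_sub_smul_notMem D'.X S'.lgs.regular q (one_ne_zero (α := k)) 0
      (by simpa using hq) ?_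
    simpa using hv
  · rw [← huv, add_sub_cancel_left]
    exact hv

/-- Were `Q` in the maximal ideal, the remainder of degree less than `q` in `z` would have to carry
the leading form `c z^q` of `h'`. -/
theorem Situation.isUnit_of_h_eq (S : Situation R B q D) (S' : Situation R B q D') (hq : 0 < q)
    {P : Polynomial (MvPowerSeries (Fin 2) k)} {Q : Loc k} (hP : P.natDegree < q)
    (h : D'.h = S.lgs.regular.coord (zPoly P) + D.h * Q) : IsUnit Q := by
  obtain ⟨c, hc, hmem⟩ := S.exists_smul_sub_mem S' hq
  by_contra hn
  have hhq : D.h ∈ maxIdeal k ^ q := by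
    have h1 := Ideal.pow_le_pow_right (Nat.le_succ q) S.lgs.congr
    simpa using Ideal.add_mem _ h1 (Ideal.pow_mem_pow (S.lgs.regular.mem 2) q)
  have hhQ : D.h * Q ∈ maxIdeal k ^ (q + 1) := by
    rw [pow_succ]
    exact Ideal.mul_mem_mul hhq ((IsLocalRing.mem_maximalIdeal _).2 hn)
  refine coord_zPoly_sub_smul_notMem D.X S.lgs.regular q hc P hP ?_
  have e1 : S.lgs.regular.coord (zPoly P) - c • D.X 2 ^ q =
      (D'.h - D'.X 2 ^ q) + (D'.X 2 ^ q - c • D.X 2 ^ q) - D.h * Q := by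
    rw [h]
    ring
  rw [e1]
  exact Ideal.sub_mem _ (Ideal.add_mem _ S'.lgs.congr hmem) hhQ

/-- Writing `c = d^q`, the relation between leading forms becomes `(z' - d z)^q ∈ m^(q+1)` by
additivity of Frobenius, so `z' - d z` has order at least 2. -/
theorem Situation.exists_smul_sub_mem_sq [IsAlgClosed k] (p e : ℕ) [ExpChar k p]
    (S : Situation R B (p ^ e) D) (S' : Situation R B (p ^ e) D') :
    ∃ d : k, d ≠ 0 ∧ D'.X 2 - d • D.X 2 ∈ maxIdeal k ^ 2 := by
  have := expChar_mvPowerSeries (k := k) (σ := Fin 3) p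
  have hq : 0 < p ^ e := expChar_pow_pos k p e
  obtain ⟨c, hc, hmem⟩ := S.exists_smul_sub_mem S' hq
  obtain ⟨d, rfl⟩ := IsAlgClosed.exists_pow_nat_eq c hq
  refine ⟨d, fun h => hc (by rw [h, zero_pow hq.ne']), ?_⟩
  rw [← smul_pow, ← sub_pow_expChar_pow, MvPowerSeries.mem_maximalIdeal_pow_iff] at hmem
  rw [MvPowerSeries.mem_maximalIdeal_pow_iff]
  have hpow := MvPowerSeries.order_prod (fun _ : ℕ => D'.X 2 - d • D.X 2) (Finset.range (p ^ e))
  rw [Finset.prod_const, Finset.card_range, Finset.sum_const, Finset.card_range] at hpow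
  rw [hpow] at hmem
  rcases eq_top_or_exists_eq_natCast (D'.X 2 - d • D.X 2).order with h | ⟨n, h⟩
  · exact h ▸ le_top
  · rw [h, nsmul_eq_mul] at hmem
    have h1 : p ^ e + 1 ≤ p ^ e * n := by exact_mod_cast hmem
    have h2 : 2 ≤ n := by
      by_contra hn
      have : n ≤ 1 := by omega
      have := Nat.mul_le_mul_left (p ^ e) this
      omega
    rw [h]
    exact_mod_cast h2

/-- A series with linear part a nonzero multiple of `Z` vanishes on a graph `Z = φ(X, Y)`. -/
theorem exists_evalZ_eq_zero {G : Loc k} {d : k} (hd : d ≠ 0)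
    (hG : G - d • MvPowerSeries.X 2 ∈ maxIdeal k ^ 2) :
    ∃ (φ : MvPowerSeries (Fin 2) k)
      (hφ : φ ∈ IsLocalRing.maximalIdeal (MvPowerSeries (Fin 2) k)), evalZ φ hφ G = 0 := by
  classical
  have hH : d⁻¹ • G - MvPowerSeries.X 2 ^ 1 ∈ maxIdeal k ^ (1 + 1) := by
    have h1 := Submodule.smul_mem ((maxIdeal k ^ 2).restrictScalars k) d⁻¹ hG
    rw [smul_sub, smul_smul, inv_mul_cancel₀ hd, one_smul] at h1
    rwa [pow_one]
  -- The implicit function theorem as division of `Z` in degree one: `Z = φ + d⁻¹ G Q`. Setting `Z =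
  -- φ` gives `0 = d⁻¹ G(φ) Q(φ)`, and `Q` is a unit by comparison of linear terms.
  obtain ⟨P, Q, hP, hPQ⟩ := exists_weierstrass_division one_pos hH (MvPowerSeries.X 2)
  obtain ⟨φ, rfl⟩ : ∃ φ, P = Polynomial.C φ :=
    ⟨P.coeff 0, Polynomial.eq_C_of_natDegree_eq_zero (by omega)⟩
  rw [zPoly_C] at hPQ
  have hHm : d⁻¹ • G ∈ maxIdeal k := by
    have h1 := Ideal.pow_le_self two_ne_zero hH
    have h2 : (MvPowerSeries.X 2 : Loc k) ∈ maxIdeal k := MvPowerSeries.mem_maximalIdeal_iff.2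
      (by simp)
    rw [pow_one] at h1
    simpa using Ideal.add_mem _ h1 h2
  have hφ : φ ∈ IsLocalRing.maximalIdeal (MvPowerSeries (Fin 2) k) := by
    have h1 := congrArg MvPowerSeries.constantCoeff hPQ
    rw [map_add, map_mul, MvPowerSeries.mem_maximalIdeal_iff.1 hHm, zero_mul, add_zero,
      MvPowerSeries.constantCoeff_X, planeEmb, MvPowerSeries.constantCoeff_rename] at h1
    exact MvPowerSeries.mem_maximalIdeal_iff.2 h1.symm
  have hQ : IsUnit Q := by
    by_contra hn
    have h1 : (MvPowerSeries.X 2 : Loc k) - planeEmb φ ∈ maxIdeal k ^ 2 := by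
      rw [sub_eq_iff_eq_add'.2 hPQ, pow_two]
      exact Ideal.mul_mem_mul hHm ((IsLocalRing.mem_maximalIdeal _).2 hn)
    have h2 := MvPowerSeries.mem_maximalIdeal_pow_iff_coeff.1 h1 (Finsupp.single 2 1)
      (by rw [Finsupp.degree_single]; omega)
    have h3 := coeff_planeEmb_mul_X_pow φ 0 (Finsupp.single 2 1)
    rw [pow_zero, mul_one, if_neg (by simp)] at h3
    rw [map_sub, h3, MvPowerSeries.coeff_X, if_pos rfl] at h2
    simp at h2
  refine ⟨φ, hφ, ?_⟩
  have h1 := congrArg (evalZ φ hφ) hPQ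
  rw [evalZ_X, map_add, evalZ_planeEmb, map_mul, map_smul] at h1
  have h2 : d⁻¹ • evalZ φ hφ G * evalZ φ hφ Q = 0 := by simpa using h1
  rw [(hQ.map (evalZ φ hφ)).mul_left_eq_zero] at h2
  exact (smul_eq_zero_iff_right (inv_ne_zero hd)).1 h2

theorem Situation.mu_eq_mu (S : Situation R B q D) (S' : Situation R B q D') (hq : 0 < q)
    (pt : Place) : mu R q D pt = mu R q D' pt := by
  obtain ⟨α, β, a, M⟩ := monomialCondition_iff.1 S.monomial
  obtain ⟨α', β', a', M'⟩ := monomialCondition_iff.1 S'.monomial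
  have key : ∀ {α β a α' β' a' : ℕ}, 0 < a → 0 < a' → α' * a ≤ α * a' ∧ β' * a ≤ β * a' →
      ((α' * pt.weight 0 + β' * pt.weight 1 : ℕ) : ℝ≥0∞) / (a' : ℝ≥0∞) ≤
        ((α * pt.weight 0 + β * pt.weight 1 : ℕ) : ℝ≥0∞) / (a : ℝ≥0∞) := by
    intro α β a α' β' a' ha ha' ⟨h1, h2⟩
    rw [natCast_div_le_div_iff ha' ha]
    calc (α' * pt.weight 0 + β' * pt.weight 1) * a
        = α' * a * pt.weight 0 + β' * a * pt.weight 1 := by ring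
      _ ≤ α * a' * pt.weight 0 + β * a' * pt.weight 1 :=
        Nat.add_le_add (Nat.mul_le_mul_right _ h1) (Nat.mul_le_mul_right _ h2)
      _ = _ := by ring
  rw [M.mu_eq S.lgs.regular hq, M'.mu_eq S'.lgs.regular hq]
  exact le_antisymm (key M'.pos M.pos (M'.mul_le_mul M S' S hq))
    (key M.pos M'.pos (M.mul_le_mul M' S S' hq))

/-- Only the place of `y` can move, and only when there is no second component; then `β = 0` makes
`μ` vanish there. -/
theorem Situation.ideal_eq_or_mu_eq_zero (S : Situation R B q D) (S' : Situation R B q D')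
    (hq : 0 < q) (pt : Place) : pt.ideal D.X = pt.ideal D'.X ∨ mu R q D pt = 0 := by
  cases pt with
  | P => exact Or.inl rfl
  | xiX => exact Or.inl (S.eq_x.trans S'.eq_x.symm)
  | xiY =>
    rcases hB : B.Hy with _ | J
    · obtain ⟨α, β, a, M⟩ := monomialCondition_iff.1 S.monomial
      right
      rw [M.mu_eq S.lgs.regular hq, M.exp_eq_zero hB]
      simp [Place.weight]
    · exact Or.inl ((S.eq_y J (by simp [hB])).trans (S'.eq_y J (by simp [hB])).symm)

theorem mem_pow_succ_of_lt_div {J : Ideal (Loc k)} {f : Loc k} {N : ℕ}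
    (h : (N : ℝ≥0∞) / (q : ℝ≥0∞) < (ordAt J f : ℝ≥0∞) / (q : ℝ≥0∞)) : f ∈ J ^ (N + 1) := by
  rw [← le_ordAt_iff]
  have h1 : (N : ℝ≥0∞) < (ordAt J f : ℝ≥0∞) := by
    by_contra hn
    exact absurd h (not_lt.2 (ENNReal.div_le_div_right (not_lt.1 hn) _))
  have h2 : (N : ℕ∞) < ordAt J f := by
    rwa [← ENat.toENNReal_coe, ENat.toENNReal_lt] at h1
  push_cast
  exact Order.add_one_le_of_lt h2

theorem exists_mul_lt_mul_of_lt_div {i N : ℕ} {o : ℕ∞} (hq : 0 < q) (hi : 0 < i)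
    (h : (N : ℝ≥0∞) / (q : ℝ≥0∞) < (o : ℝ≥0∞) / (i : ℝ≥0∞)) :
    ∃ b : ℕ, i * N < q * b ∧ (b : ℕ∞) ≤ o := by
  rcases eq_top_or_exists_eq_natCast o with rfl | ⟨b, rfl⟩
  · exact ⟨i * N + 1, lt_of_lt_of_le (Nat.lt_succ_self _) (Nat.le_mul_of_pos_left _ hq), le_top⟩
  · refine ⟨b, ?_, le_rfl⟩
    by_contra hn
    refine absurd h (not_lt.2 ?_)
    rw [ENat.toENNReal_coe, natCast_div_le_div_iff hi hq]
    linarith [not_lt.1 hn]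

/-- The slope of a well-adapted choice is maximal. -/
theorem WellAdapted.slope_le [IsAlgClosed k] (p e : ℕ) [ExpChar k p] {pt : Place}
    (W : WellAdapted R (p ^ e) D pt) (S : Situation R B (p ^ e) D)
    (S' : Situation R B (p ^ e) D') : slope R (p ^ e) D' pt ≤ slope R (p ^ e) D pt := by
  have hq : 0 < p ^ e := expChar_pow_pos k p e
  have hmu := S.mu_eq_mu S' hq pt
  rcases W with W | ⟨W1, W2, W3⟩
  · rw [W, hmu]
    exact min_le_right _ _
  rw [W1]
  by_contra! hlt
  refine W3 ?_
  have hJ : pt.ideal D.X = pt.ideal D'.X := by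
    rcases S.ideal_eq_or_mu_eq_zero S' hq pt with h | h
    · exact h
    · exact absurd (h ▸ W2) not_lt_zero
  have hX := S.lgs.regular
  have hX' := S'.lgs.regular
  obtain ⟨N, hN⟩ : ∃ N : ℕ, (D.a (p ^ e)).weightedOrder pt.weight = N := by
    rcases eq_top_or_exists_eq_natCast ((D.a (p ^ e)).weightedOrder pt.weight) with h | h
    · rw [ordRatio, ordAt_plane hX, h, ENat.toENNReal_top,
        ENNReal.top_div_of_ne_top (ENNReal.natCast_ne_top _)] at W2
      exact absurd W2 not_top_lt
    · exact h
  have hr : ordRatio (p ^ e) D pt = (N : ℝ≥0∞) / ((p ^ e : ℕ) : ℝ≥0∞) := by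
    rw [ordRatio, ordAt_plane hX, hN, ENat.toENNReal_coe]
  rw [hr] at hlt W2
  obtain ⟨d, hd, hdm⟩ := S.exists_smul_sub_mem_sq p e S'
  obtain ⟨φ, hφ, hφz⟩ := exists_evalZ_eq_zero (G := hX.coord.symm (D'.X 2)) hd (by
    rw [← map_mem_maxIdeal_pow_iff hX.coord]
    simpa using hdm)
  refine exists_pow_eq_initialForm p e pt hN (fun i hi => ?_) (φ := φ) ?_
  · exact exists_mul_lt_mul_of_lt_div hq (Finset.mem_Ico.1 hi).1
      (W2.trans_le (S.mu_le_weightedOrder_coeff pt hi))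
  obtain ⟨P, Q, hP, hc, hPQ⟩ := exists_isConstTerm hX hq S.lgs.congr D'.h
  have hQ : IsUnit Q := S.isUnit_of_h_eq S' hq hP hPQ
  have hc0 : hX.coord (zPoly P) ∈ pt.ideal D.X ^ (N + 1) :=
    mem_pow_succ_of_lt_div (W2.trans_le (sInf_le ⟨_, _, _, hq, S'.lgs.mem, hc, rfl⟩))
  have hlast : plane D'.X (D'.a (p ^ e)) ∈ pt.ideal D.X ^ (N + 1) := by
    rw [hJ]
    exact mem_pow_succ_of_lt_div (hlt.trans_le (min_le_left _ _))
  -- On the graph where `z'` vanishes, only the last coefficient of `h'` survives.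
  have hh : evalZ φ hφ (hX.coord.symm D'.h) =
      evalZ φ hφ (hX.coord.symm (plane D'.X (D'.a (p ^ e)))) := by
    rw [S'.weierstrass, ← Finset.Ico_insert_right (show 1 ≤ p ^ e from hq),
      Finset.sum_insert (by simp)]
    simp only [map_add, map_mul, map_pow, map_sum, hφz, Nat.sub_self, pow_zero, mul_one]
    rw [zero_pow hq.ne', zero_add, Finset.sum_eq_zero, add_zero]
    intro i hi
    have := (Finset.mem_Ico.1 hi).2
    rw [zero_pow (by omega), mul_zero]
  -- Restricting `h Q = h' - c₀` to the graph: both terms on the right have order above `N`, and the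
  -- unit `Q` can be dropped.
  have heval : (D.poly (p ^ e)).eval φ * evalZ φ hφ (hX.coord.symm Q) ∈
      pt.planeIdeal ^ (N + 1) := by
    have h1 : D.h * Q = D'.h - hX.coord (zPoly P) := by
      rw [hPQ, add_sub_cancel_left]
    have h2 := congrArg (fun f => evalZ φ hφ (hX.coord.symm f)) h1
    simp only [map_mul, map_sub] at h2
    rw [S.h_eq hX, AlgEquiv.symm_apply_apply, evalZ_zPoly, hh] at h2
    rw [h2]
    exact Ideal.sub_mem _ (evalZ_coord_symm_mem hX pt hφ hlast) (evalZ_coord_symm_mem hX pt hφ hc0)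
  rw [Ideal.mul_unit_mem_iff_mem _ ((hQ.map hX.coord.symm).map (evalZ φ hφ))] at heval
  exact pt.mem_planeIdeal_pow_iff.1 heval

end compare

/-! ### Translations of the third parameter -/

/-- The system of parameters `(x, y, z - ψ(x, y))`. -/
def translate (X : Fin 3 → Loc k) (ψ : MvPowerSeries (Fin 2) k) : Fin 3 → Loc k :=
  ![X 0, X 1, X 2 - plane X ψ]

theorem plane_translate (X : Fin 3 → Loc k) (ψ F : MvPowerSeries (Fin 2) k) :
    plane (translate X ψ) F = plane X F := rfl

section translate

variable {X : Fin 3 → Loc k} {ψ : MvPowerSeries (Fin 2) k}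

theorem IsRegularSystem.translate (hX : IsRegularSystem X)
    (hψ : ψ ∈ IsLocalRing.maximalIdeal (MvPowerSeries (Fin 2) k)) :
    IsRegularSystem (translate X ψ) := by
  have hpl : plane X ψ ∈ maxIdeal k := by
    have := plane_mem_pow hX Place.P (n := 1) (by rw [pow_one]; exact hψ)
    rwa [pow_one] at this
  refine le_antisymm (Ideal.span_le.2 ?_) ?_
  · rintro _ ⟨i, rfl⟩
    fin_cases i
    · exact hX.mem 0
    · exact hX.mem 1
    · exact Ideal.sub_mem _ (hX.mem 2) hpl
  · have h0 : X 0 ∈ Ideal.span (Set.range (MonomialCase.translate X ψ)) :=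
      Ideal.subset_span ⟨0, rfl⟩
    have h1 : X 1 ∈ Ideal.span (Set.range (MonomialCase.translate X ψ)) :=
      Ideal.subset_span ⟨1, rfl⟩
    have h2 : X 2 - plane X ψ ∈ Ideal.span (Set.range (MonomialCase.translate X ψ)) :=
      Ideal.subset_span ⟨2, rfl⟩
    have hp : plane X ψ ∈ Ideal.span (Set.range (MonomialCase.translate X ψ)) := by
      rw [MvPowerSeries.maximalIdeal_eq_span_X] at hψ
      obtain ⟨c, hc⟩ := Ideal.mem_span_range_iff_exists_fun.1 hψ
      have hc' := congrArg (fun F => hX.coord (planeEmb F)) hc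
      simp only [Fin.sum_univ_two, map_add, map_mul, planeEmb_X, hX.coord_X] at hc'
      rw [hX.plane_eq, ← hc']
      exact Ideal.add_mem _ (Ideal.mul_mem_left _ _ h0) (Ideal.mul_mem_left _ _ h1)
    rw [← (hX : Ideal.span (Set.range X) = maxIdeal k), Ideal.span_le]
    rintro _ ⟨i, rfl⟩
    fin_cases i
    · exact h0
    · exact h1
    · simpa using Ideal.add_mem _ h2 hp

theorem coord_translate_zPoly (hX : IsRegularSystem X) (hX' : IsRegularSystem (translate X ψ))
    (P : Polynomial (MvPowerSeries (Fin 2) k)) :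
    hX'.coord (zPoly P) = hX.coord (zPoly (Polynomial.taylor (-ψ) P)) := by
  induction P using Polynomial.induction_on' with
  | add P Q hP hQ => simp [hP, hQ]
  | monomial n F =>
    rw [zPoly_monomial, map_mul, map_pow, hX'.coord_X, ← hX'.plane_eq, plane_translate,
      hX.plane_eq, Polynomial.taylor_monomial, map_mul, map_pow, map_add, zPoly_C, zPoly_C, zPoly_X,
      map_mul, map_pow, map_add, hX.coord_X, map_neg, map_neg, ← hX.plane_eq, ← hX.plane_eq,
      ← sub_eq_add_neg]
    rfl

theorem coord_zPoly_eq_translate (hX : IsRegularSystem X) (hX' : IsRegularSystem (translate X ψ))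
    (P : Polynomial (MvPowerSeries (Fin 2) k)) :
    hX.coord (zPoly P) = hX'.coord (zPoly (Polynomial.taylor ψ P)) := by
  rw [coord_translate_zPoly hX hX', Polynomial.taylor_taylor, neg_add_cancel,
    Polynomial.taylor_zero]

/-- Polynomials of degree less than `q` over `k[[x, y]]` are the same in `z` and in `z - ψ`; an
expansion in one system is an expansion in the other. -/
theorem IsConstTerm.of_translate {q : ℕ} (hq : 0 < q) (hX : IsRegularSystem X)
    (hX' : IsRegularSystem (translate X ψ)) {h f c₀ : Loc k}
    (hc : IsConstTerm q (translate X ψ) h f c₀) : IsConstTerm q X h f c₀ := by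
  obtain ⟨c, ⟨h1, h2⟩, rfl⟩ := hc
  refine ⟨c, ⟨fun b => ?_, h2⟩, rfl⟩
  obtain ⟨P, hP, hPc⟩ := (exists_sum_plane_iff hX' hq _).1 (h1 b)
  refine (exists_sum_plane_iff hX hq _).2 ⟨Polynomial.taylor (-ψ) P, ?_, ?_⟩
  · rwa [Polynomial.natDegree_taylor]
  · rw [hPc, coord_translate_zPoly hX hX']

/-- For polynomials in `Z` this is commutation with Taylor shifts; the general case follows by
truncation, cut at `N + n` because the derivative loses `n` orders. -/
theorem coord_symm_coord_translate_hasseZ (hX : IsRegularSystem X)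
    (hX' : IsRegularSystem (translate X ψ)) (n : ℕ) (F : Loc k) :
    hX.coord.symm (hX'.coord (hasseZ n F)) = hasseZ n (hX.coord.symm (hX'.coord F)) := by
  rw [← sub_eq_zero]
  refine MvPowerSeries.eq_zero_of_forall_mem_maximalIdeal_pow fun N => ?_
  set P := lowPoly (N + n) F with hP
  have hFP : F - zPoly P ∈ maxIdeal k ^ (N + n) := by
    rw [sub_eq_iff_eq_add'.2 (lowPoly_add_highPart (N + n) F)]
    exact Ideal.mul_mem_right _ _ (Ideal.pow_mem_pow (MvPowerSeries.mem_maximalIdeal_iff.2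
      (by simp)) _)
  have hpoly : hX.coord.symm (hX'.coord (hasseZ n (zPoly P))) =
      hasseZ n (hX.coord.symm (hX'.coord (zPoly P))) := by
    rw [coord_translate_zPoly hX hX', AlgEquiv.symm_apply_apply, hasseZ_zPoly, hasseZ_zPoly,
      coord_translate_zPoly hX hX', AlgEquiv.symm_apply_apply, hasseDeriv_taylor]
  have e1 : hX.coord.symm (hX'.coord (hasseZ n F)) - hasseZ n (hX.coord.symm (hX'.coord F)) =
      hX.coord.symm (hX'.coord (hasseZ n (F - zPoly P))) -
        hasseZ n (hX.coord.symm (hX'.coord (F - zPoly P))) := by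
    simp only [hasseZ_sub, map_sub, hpoly]
    ring
  rw [e1]
  refine Ideal.sub_mem _ ?_ ?_
  · rw [map_mem_maxIdeal_pow_iff, map_mem_maxIdeal_pow_iff]
    simpa using hasseZ_mem (n := n) hFP
  · have := hasseZ_mem (n := n) ((map_mem_maxIdeal_pow_iff hX.coord.symm).2
      ((map_mem_maxIdeal_pow_iff hX'.coord).2 hFP))
    simpa using this

theorem IdealisticFiltration.ZSaturated.translate {R : IdealisticFiltration k}
    (hR : R.ZSaturated X) (hX : IsRegularSystem X)
    (hX' : IsRegularSystem (MonomialCase.translate X ψ)) :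
    R.ZSaturated (MonomialCase.translate X ψ) := by
  intro a n F hF
  rw [← hX'.coord_apply] at hF ⊢
  have h := hR a n (hX.coord.symm (hX'.coord F)) (by
    rwa [← hX.coord_apply, AlgEquiv.apply_symm_apply])
  rwa [← coord_symm_coord_translate_hasseZ hX hX', ← hX.coord_apply,
    AlgEquiv.apply_symm_apply] at h

theorem pow_sub_pow_mem {z z' : Loc k} (hz : z ∈ maxIdeal k) (hz' : z' ∈ maxIdeal k)
    (h : z' - z ∈ maxIdeal k ^ 2) (a : ℕ) : z' ^ a - z ^ a ∈ maxIdeal k ^ (a + 1) := by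
  induction a with
  | zero => simp
  | succ a ih =>
    have e1 : z' ^ (a + 1) - z ^ (a + 1) = (z' ^ a - z ^ a) * z' + z ^ a * (z' - z) := by ring
    rw [e1]
    refine Ideal.add_mem _ ?_ ?_
    · rw [pow_succ _ (a + 1)]
      exact Ideal.mul_mem_mul ih hz'
    · rw [show a + 1 + 1 = a + 2 from rfl, pow_add]
      exact Ideal.mul_mem_mul (Ideal.pow_mem_pow hz a) h

theorem IdealisticFiltration.LeadingAlgebraEq.congr {R : IdealisticFiltration k} {q : ℕ}
    {z z' : Loc k} (hR : R.LeadingAlgebraEq q z) (hz : ∀ a, z' ^ a - z ^ a ∈ maxIdeal k ^ (a + 1)) :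
    R.LeadingAlgebraEq q z' := by
  intro a
  rw [hR a]
  have key : ∀ {z z' : Loc k}, z' ^ a - z ^ a ∈ maxIdeal k ^ (a + 1) →
      Submodule.span k {f | q ∣ a ∧ f = z ^ a} ⊔ (maxIdeal k ^ (a + 1)).restrictScalars k ≤
        Submodule.span k {f | q ∣ a ∧ f = z' ^ a} ⊔
          (maxIdeal k ^ (a + 1)).restrictScalars k := by
    intro z z' h
    refine sup_le (Submodule.span_le.2 ?_) le_sup_right
    rintro _ ⟨hqa, rfl⟩
    refine Submodule.mem_sup.2 ⟨z' ^ a, Submodule.subset_span ⟨hqa, rfl⟩, z ^ a - z' ^ a, ?_,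
      by ring⟩
    rw [Submodule.restrictScalars_mem, ← neg_sub]
    exact neg_mem h
  refine le_antisymm (key (hz a)) (key ?_)
  rw [← neg_sub]
  exact neg_mem (hz a)

end translate

theorem degree_eq_degree_planeExp_add (d : Fin 3 →₀ ℕ) : d.degree = (planeExp d).degree + d 2 := by
  rw [Finsupp.degree_eq_sum, Finsupp.degree_eq_sum, Fin.sum_univ_three, Fin.sum_univ_two]
  rfl

theorem planeExp_embDomain_add (d : Fin 2 →₀ ℕ) (j : ℕ) :
    planeExp (d.embDomain Fin.castSuccEmb + Finsupp.single 2 j) = d := by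
  ext i
  have := Finsupp.embDomain_apply_self (Fin.castSuccEmb : Fin 2 ↪ Fin 3) d i
  fin_cases i <;> simpa [planeExp] using this

theorem embDomain_add_apply_two (d : Fin 2 →₀ ℕ) (j : ℕ) :
    (d.embDomain (Fin.castSuccEmb : Fin 2 ↪ Fin 3) + Finsupp.single (2 : Fin 3) j :
      Fin 3 →₀ ℕ) 2 = j := by
  simp [embDomain_castSuccEmb_two]

/-- The order condition on the coefficients follows from the leading term. -/
theorem coeff_order_of_congr {D : Choice k} {q : ℕ} (hX : IsRegularSystem D.X)
    (h : hX.coord (zPoly (D.poly q)) - D.X 2 ^ q ∈ maxIdeal k ^ (q + 1)) {i : ℕ}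
    (hi : i ∈ Finset.Icc 1 q) : (i : ℕ∞) < ordAt (maxIdeal k) (plane D.X (D.a i)) := by
  classical
  have hi' := Finset.mem_Icc.1 hi
  refine lt_of_lt_of_le (by exact_mod_cast Nat.lt_succ_self i : (i : ℕ∞) < ((i + 1 : ℕ) : ℕ∞)) ?_
  refine le_ordAt_iff.2 (plane_mem_pow hX Place.P (n := i + 1) ?_)
  refine MvPowerSeries.mem_maximalIdeal_pow_iff_coeff.2 fun d hd => ?_
  rw [← map_mem_maxIdeal_pow_iff hX.coord.symm, map_sub, map_pow, hX.coord_symm,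
    AlgEquiv.symm_apply_apply, MvPowerSeries.mem_maximalIdeal_pow_iff_coeff] at h
  have h1 := h (d.embDomain Fin.castSuccEmb + Finsupp.single 2 (q - i)) (by
    rw [degree_eq_degree_planeExp_add, planeExp_embDomain_add, embDomain_add_apply_two]
    omega)
  rw [map_sub, coeff_zPoly, planeExp_embDomain_add, embDomain_add_apply_two, D.coeff_poly_sub hi,
    MvPowerSeries.coeff_X_pow, if_neg, sub_zero] at h1
  · exact h1
  · intro heq
    have := DFunLike.congr_fun heq 2
    rw [embDomain_add_apply_two, Finsupp.single_eq_same] at this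
    omega

theorem Choice.coeff_poly_self (D : Choice k) (q : ℕ) : (D.poly q).coeff q = 1 := by
  rw [poly, Polynomial.coeff_add, Polynomial.coeff_X_pow, if_pos rfl, Polynomial.finsetSum_coeff,
    Finset.sum_eq_zero, add_zero]
  intro i hi
  have := Finset.mem_Icc.1 hi
  rw [Polynomial.coeff_monomial, if_neg (by omega)]

theorem Choice.natDegree_poly (D : Choice k) (q : ℕ) : (D.poly q).natDegree = q :=
  le_antisymm (D.natDegree_poly_le q)
    (Polynomial.le_natDegree_of_ne_zero (by rw [D.coeff_poly_self]; exact one_ne_zero))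

/-- The choice obtained by replacing `z` with `z - ψ(x, y)`. -/
def Choice.translate (D : Choice k) (q : ℕ) (ψ : MvPowerSeries (Fin 2) k) : Choice k where
  X := MonomialCase.translate D.X ψ
  h := D.h
  a := fun i => (Polynomial.taylor ψ (D.poly q)).coeff (q - i)

theorem Choice.translate_poly (D : Choice k) (q : ℕ) (ψ : MvPowerSeries (Fin 2) k) :
    (D.translate q ψ).poly q = Polynomial.taylor ψ (D.poly q) := by
  have hdeg : (Polynomial.taylor ψ (D.poly q)).natDegree = q := by
    rw [Polynomial.natDegree_taylor, D.natDegree_poly]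
  ext1 n
  rcases lt_trichotomy n q with h | rfl | h
  · have h1 := (D.translate q ψ).coeff_poly_sub (q := q) (i := q - n)
      (Finset.mem_Icc.2 ⟨by omega, by omega⟩)
    have h2 : q - (q - n) = n := by omega
    rw [h2] at h1
    rw [h1]
    change (Polynomial.taylor ψ (D.poly q)).coeff (q - (q - n)) = _
    rw [h2]
  · rw [Choice.coeff_poly_self]
    have h1 := Polynomial.coeff_taylor_natDegree (f := D.poly n) (r := ψ)
    rw [Polynomial.leadingCoeff, D.natDegree_poly, D.coeff_poly_self] at h1
    exact h1.symm
  · rw [Polynomial.coeff_eq_zero_of_natDegree_lt (lt_of_le_of_lt (Choice.natDegree_poly_le _ q) h),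
      Polynomial.coeff_eq_zero_of_natDegree_lt (by omega)]

theorem Choice.translate_a_self (D : Choice k) (q : ℕ) (ψ : MvPowerSeries (Fin 2) k) :
    (D.translate q ψ).a q = (D.poly q).eval ψ := by
  change (Polynomial.taylor ψ (D.poly q)).coeff (q - q) = _
  rw [Nat.sub_self, Polynomial.taylor_coeff_zero]

theorem IsMonomialDatum.translate {α β a : ℕ} (M : IsMonomialDatum R B q D.X D.h α β a)
    (hq : 0 < q) (hX : IsRegularSystem D.X) {ψ : MvPowerSeries (Fin 2) k}
    (hψ : ψ ∈ IsLocalRing.maximalIdeal (MvPowerSeries (Fin 2) k)) :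
    IsMonomialDatum R B q (D.translate q ψ).X (D.translate q ψ).h α β a :=
  ⟨M.pos, M.exp_eq_zero, M.mem, fun lam f c₀ hf hc =>
    M.dvd lam f c₀ hf (hc.of_translate hq hX (hX.translate hψ))⟩

/-- Taking `ψ` in `m²` keeps the class of `z` modulo `m²`, hence the leading algebra and the leading
form of `h`; the remaining conditions are insensitive to a translation of `z`. -/
theorem Situation.translate (S : Situation R B q D) (hq : 0 < q) {ψ : MvPowerSeries (Fin 2) k}
    (hψ : ψ ∈ IsLocalRing.maximalIdeal (MvPowerSeries (Fin 2) k) ^ 2) :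
    Situation R B q (D.translate q ψ) := by
  have hψ1 := Ideal.pow_le_self two_ne_zero hψ
  have hX := S.lgs.regular
  have hX' : IsRegularSystem (D.translate q ψ).X := hX.translate hψ1
  have hz : (D.translate q ψ).X 2 - D.X 2 ∈ maxIdeal k ^ 2 := by
    have := plane_mem_pow hX Place.P (n := 2) hψ
    change D.X 2 - plane D.X ψ - D.X 2 ∈ maxIdeal k ^ 2
    rw [sub_sub_cancel_left]
    exact neg_mem this
  have hpow := pow_sub_pow_mem (hX.mem 2) (hX'.mem 2) hz
  have hh : (D.translate q ψ).h = hX'.coord (zPoly ((D.translate q ψ).poly q)) := by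
    rw [D.translate_poly]
    exact (S.h_eq hX).trans (coord_zPoly_eq_translate hX hX' _)
  have hcongr : (D.translate q ψ).h - (D.translate q ψ).X 2 ^ q ∈ maxIdeal k ^ (q + 1) := by
    have := Ideal.sub_mem _ S.lgs.congr (hpow q)
    rwa [sub_sub_sub_cancel_right] at this
  obtain ⟨α, β, a, M⟩ := monomialCondition_iff.1 S.monomial
  exact
    { lgs := ⟨hX', S.lgs.leading.congr hpow, S.lgs.mem, hcongr⟩
      eq_x := S.eq_x
      eq_y := S.eq_y
      weierstrass := by rw [hh, Choice.coord_zPoly_poly]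
      ord_coeff := fun i hi => coeff_order_of_congr hX' (hh ▸ hcongr) hi
      monomial := monomialCondition_iff.2 ⟨α, β, a, M.translate hq hX hψ1⟩
      saturated := S.saturated.translate hX hX' }

/-! ### Removing monomials that are powers -/

variable {α β a : ℕ}

theorem coeff_sum_mul_pow_eq_zero {w : Fin 2 → ℕ} {γ ρ L : ℕ}
    {A : ℕ → MvPowerSeries (Fin 2) k} {ψ : MvPowerSeries (Fin 2) k}
    (hA : ∀ i ∈ Finset.Ico 1 q, ((γ * i : ℕ) : ℕ∞) ≤ (A i).weightedOrder w)
    (hψ : (ρ : ℕ∞) ≤ ψ.weightedOrder w) (hL : ∀ i ∈ Finset.Ico 1 q, L ≤ γ * i + (q - i) * ρ)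
    {d : Fin 2 →₀ ℕ} (hd : Finsupp.weight w d < L) :
    MvPowerSeries.coeff d (∑ i ∈ Finset.Ico 1 q, A i * ψ ^ (q - i)) = 0 := by
  refine le_weightedOrder_iff.1 (le_weightedOrder_sum _ _ fun i hi => ?_) d hd
  refine le_trans (Nat.cast_le.2 (hL i hi)) (le_trans ?_ (MvPowerSeries.le_weightedOrder_mul w))
  push_cast
  refine add_le_add (by exact_mod_cast hA i hi)
    (le_trans ?_ (MvPowerSeries.le_weightedOrder_pow w _))
  rw [nsmul_eq_mul]
  exact mul_le_mul_right hψ _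

/-- Giving `X` the weight `a` clears the denominator in `αi/a`, so the bound is an integer without
rounding. -/
theorem IsMonomialDatum.le_weightedOrder_coeff_fst (M : IsMonomialDatum R B q D.X D.h α β a)
    (S : Situation R B q D) {i : ℕ} (hi : i ∈ Finset.Ico 1 q) :
    ((α * i : ℕ) : ℕ∞) ≤ (D.a i).weightedOrder ![a, 0] := by
  refine le_weightedOrder_iff.2 fun d hd => MvPowerSeries.X_pow_dvd_iff.1
    ((Dvd.intro _ rfl).trans (M.dvd_coeff S hi)) d ?_
  rw [weight_apply_fin_two] at hd
  by_contra hn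
  have := mul_le_mul_of_ceil_le M.pos (not_lt.1 hn)
  simp at hd
  omega

theorem IsMonomialDatum.le_weightedOrder_coeff_snd (M : IsMonomialDatum R B q D.X D.h α β a)
    (S : Situation R B q D) {i : ℕ} (hi : i ∈ Finset.Ico 1 q) :
    ((β * i : ℕ) : ℕ∞) ≤ (D.a i).weightedOrder ![0, a] := by
  refine le_weightedOrder_iff.2 fun d hd => MvPowerSeries.X_pow_dvd_iff.1
    ((Dvd.intro_left _ rfl).trans (M.dvd_coeff S hi)) d ?_
  rw [weight_apply_fin_two] at hd
  by_contra hn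
  have := mul_le_mul_of_ceil_le M.pos (not_lt.1 hn)
  simp at hd
  omega

/-- The difference of the right side and `q ρ` is `i (γ - ρ)`, at least 1 as `i ≥ 1`. -/
theorem mul_add_one_le {γ ρ i : ℕ} (hi : i ∈ Finset.Ico 1 q) (h : ρ < γ) :
    q * ρ + 1 ≤ γ * i + (q - i) * ρ := by
  obtain ⟨h1, h2⟩ := Finset.mem_Ico.1 hi
  obtain ⟨j, rfl⟩ := Nat.exists_eq_add_of_le h2.le
  rw [Nat.add_sub_cancel_left]
  nlinarith

/-- The translation removing from `a_q` the terms with exponent `q • d`, `d ∈ E`, provided that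
the mixed terms do not interfere. -/
theorem Situation.exists_clear [IsAlgClosed k] (p e : ℕ) [ExpChar k p]
    (S : Situation R B (p ^ e) D) (M : IsMonomialDatum R B (p ^ e) D.X D.h α β a)
    (E E' : Set (Fin 2 →₀ ℕ))
    (hE' : ∀ d ∈ E', MvPowerSeries.coeff (p ^ e • d) (D.a (p ^ e)) = 0)
    (hmix : ∀ ψ : MvPowerSeries (Fin 2) k, (∀ d ∉ E, MvPowerSeries.coeff d ψ = 0) →
      ∀ d ∈ E ∪ E', MvPowerSeries.coeff (p ^ e • d)
        (∑ i ∈ Finset.Ico 1 (p ^ e), D.a i * ψ ^ (p ^ e - i)) = 0) :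
    ∃ D' : Choice k, Situation R B (p ^ e) D' ∧
      IsMonomialDatum R B (p ^ e) D'.X D'.h α β a ∧
      ∀ d ∈ E ∪ E', MvPowerSeries.coeff (p ^ e • d) (D'.a (p ^ e)) = 0 := by
  classical
  have hq : 0 < p ^ e := expChar_pow_pos k p e
  have hroot : ∀ c : k, ∃ b : k, b ^ p ^ e = -c := fun c => IsAlgClosed.exists_pow_nat_eq _ hq
  choose root hroot using hroot
  -- The coefficients of `ψ` are `q`-th roots of the negatives of those to be removed, so that `ψ^q`
  -- cancels them.
  set ψ : MvPowerSeries (Fin 2) k := MvPowerSeries.ofCoeff fun d =>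
    if d ∈ E then root (MvPowerSeries.coeff (p ^ e • d) (D.a (p ^ e))) else 0 with hψdef
  have hord : ∀ d : Fin 2 →₀ ℕ, d.degree < p ^ e + 1 →
      MvPowerSeries.coeff d (D.a (p ^ e)) = 0 := by
    have h1 := S.ord_coeff (p ^ e) (Finset.mem_Icc.2 ⟨hq, le_rfl⟩)
    have h2 := ordAt_plane S.lgs.regular Place.P (D.a (p ^ e))
    rw [Place.ideal] at h2
    rw [h2] at h1
    have h3 := Place.P.mem_planeIdeal_pow_iff.2
      (show ((p ^ e + 1 : ℕ) : ℕ∞) ≤ _ from by push_cast at h1 ⊢; exact Order.add_one_le_of_lt h1)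
    exact MvPowerSeries.mem_maximalIdeal_pow_iff_coeff.1 h3
  -- As `ord a_q > q`, an exponent `d` of degree at most 1 has vanishing coefficient at `q • d`, and
  -- the chosen root of zero is zero.
  have hψ : ψ ∈ IsLocalRing.maximalIdeal (MvPowerSeries (Fin 2) k) ^ 2 := by
    refine MvPowerSeries.mem_maximalIdeal_pow_iff_coeff.2 fun d hd => ?_
    rw [hψdef, MvPowerSeries.coeff_ofCoeff]
    split_ifs with hdE
    · rw [hord (p ^ e • d)]
      · exact eq_zero_of_pow_eq_zero ((hroot 0).trans neg_zero)
      · rw [map_nsmul, smul_eq_mul]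
        have := Nat.mul_le_mul_left (p ^ e) (show d.degree ≤ 1 by omega)
        omega
    · rfl
  refine ⟨D.translate (p ^ e) ψ, S.translate hq hψ,
    M.translate hq S.lgs.regular (Ideal.pow_le_self two_ne_zero hψ), fun d hd => ?_⟩
  rw [D.translate_a_self, D.eval_poly hq, map_add, map_add, coeff_smul_pow_expChar_pow,
    hmix ψ (fun d hdE => by rw [hψdef, MvPowerSeries.coeff_ofCoeff, if_neg hdE]) d hd, add_zero,
    hψdef, MvPowerSeries.coeff_ofCoeff]
  split_ifs with hdE
  · rw [hroot, neg_add_cancel]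
  · rw [zero_pow hq.ne', zero_add, hE' d (hd.resolve_left hdE)]

/-- Exponents of `x` are cleared in increasing order, with all exponents of `y` at once. If `ψ` is
divisible by `x^r` with `r < α/a`, each mixed term has `x`-exponent above `q r`, so nothing at or
below the current stage is disturbed. -/
theorem Situation.exists_clear_fst [IsAlgClosed k] (p e : ℕ) [ExpChar k p]
    (S : Situation R B (p ^ e) D) (M : IsMonomialDatum R B (p ^ e) D.X D.h α β a) (r : ℕ) :
    ∃ D' : Choice k, Situation R B (p ^ e) D' ∧
      IsMonomialDatum R B (p ^ e) D'.X D'.h α β a ∧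
      ∀ d : Fin 2 →₀ ℕ, d 0 < r → a * d 0 < α →
        MvPowerSeries.coeff (p ^ e • d) (D'.a (p ^ e)) = 0 := by
  induction r with
  | zero => exact ⟨D, S, M, fun d hd => absurd hd (Nat.not_lt_zero _)⟩
  | succ r ih =>
    obtain ⟨D₁, S₁, M₁, h₁⟩ := ih
    by_cases hr : a * r < α
    · obtain ⟨D₂, S₂, M₂, h₂⟩ := S₁.exists_clear p e M₁ {d | d 0 = r} {d | d 0 < r}
        (fun d hd => h₁ d hd (lt_of_le_of_lt (Nat.mul_le_mul_left a (le_of_lt hd)) hr))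
        (fun ψ hψ d hd => by
          have hd' : d 0 ≤ r := by
            rcases hd with hd | hd
            · exact le_of_eq hd
            · exact le_of_lt hd
          refine coeff_sum_mul_pow_eq_zero (w := ![a, 0]) (ρ := a * r) (L := p ^ e * (a * r) + 1)
            (fun i hi => M₁.le_weightedOrder_coeff_fst S₁ hi)
            (le_weightedOrder_iff.2 fun d' hd' => hψ d' ?_) (fun i hi => mul_add_one_le hi hr) ?_
          · rintro rfl
            simp [weight_apply_fin_two, mul_comm] at hd'
          · rw [map_nsmul, weight_apply_fin_two, smul_eq_mul]
            simp only [Matrix.cons_val_zero, Matrix.cons_val_one, mul_zero, add_zero]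
            refine Nat.lt_succ_of_le (Nat.mul_le_mul_left _ ?_)
            rw [mul_comm]
            exact Nat.mul_le_mul_left a hd')
      refine ⟨D₂, S₂, M₂, fun d hd _ => h₂ d ?_⟩
      rcases Nat.lt_succ_iff_lt_or_eq.1 hd with hd | hd
      · exact Or.inr hd
      · exact Or.inl hd
    · refine ⟨D₁, S₁, M₁, fun d hd hda => h₁ d ?_ hda⟩
      rcases Nat.lt_succ_iff_lt_or_eq.1 hd with hd | hd
      · exact hd
      · exact absurd (hd ▸ hda) hr

/-- The same induction in `y`, using only monomials of `ψ` with `x`-exponent at least `α/a`. Then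
every mixed term has `x`-exponent at least `q α/a`, which protects what was cleared in the first
variable. -/
theorem Situation.exists_clear_snd [IsAlgClosed k] (p e : ℕ) [ExpChar k p]
    (S : Situation R B (p ^ e) D) (M : IsMonomialDatum R B (p ^ e) D.X D.h α β a)
    (hfst : ∀ d : Fin 2 →₀ ℕ, a * d 0 < α →
      MvPowerSeries.coeff (p ^ e • d) (D.a (p ^ e)) = 0) (r : ℕ) :
    ∃ D' : Choice k, Situation R B (p ^ e) D' ∧
      IsMonomialDatum R B (p ^ e) D'.X D'.h α β a ∧
      ∀ d : Fin 2 →₀ ℕ, a * d 0 < α ∨ (d 1 < r ∧ a * d 1 < β) →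
        MvPowerSeries.coeff (p ^ e • d) (D'.a (p ^ e)) = 0 := by
  have hq : 0 < p ^ e := expChar_pow_pos k p e
  induction r with
  | zero => exact ⟨D, S, M, fun d hd => hfst d (hd.resolve_right fun h => Nat.not_lt_zero _ h.1)⟩
  | succ r ih =>
    obtain ⟨D₁, S₁, M₁, h₁⟩ := ih
    by_cases hr : a * r < β
    · obtain ⟨D₂, S₂, M₂, h₂⟩ := S₁.exists_clear p e M₁ {d | d 1 = r ∧ α ≤ a * d 0}
        {d | a * d 0 < α ∨ d 1 < r}
        (fun d hd => h₁ d (hd.imp_right fun h =>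
          ⟨h, lt_of_le_of_lt (Nat.mul_le_mul_left a (le_of_lt h)) hr⟩))
        (fun ψ hψ d hd => by
          have hd' : a * d 0 < α ∨ d 1 ≤ r := by
            rcases hd with hd | hd
            · exact Or.inr (le_of_eq hd.1)
            · exact hd.imp_right le_of_lt
          rcases hd' with hd' | hd'
          · refine coeff_sum_mul_pow_eq_zero (w := ![a, 0]) (ρ := α) (L := p ^ e * α)
              (fun i hi => M₁.le_weightedOrder_coeff_fst S₁ hi)
              (le_weightedOrder_iff.2 fun d' hd' => hψ d' ?_) (fun i hi => ?_) ?_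
            · rintro ⟨-, h⟩
              simp only [weight_apply_fin_two, Matrix.cons_val_zero, Matrix.cons_val_one, mul_zero,
                add_zero] at hd'
              rw [mul_comm] at h
              omega
            · obtain ⟨j, hj⟩ := Nat.exists_eq_add_of_le (Finset.mem_Ico.1 hi).2.le
              rw [hj, Nat.add_sub_cancel_left]
              exact le_of_eq (by ring)
            · rw [map_nsmul, weight_apply_fin_two, smul_eq_mul]
              simp only [Matrix.cons_val_zero, Matrix.cons_val_one, mul_zero, add_zero]
              rw [mul_comm (d 0)]
              exact Nat.mul_lt_mul_of_pos_left hd' hq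
          · refine coeff_sum_mul_pow_eq_zero (w := ![0, a]) (ρ := a * r)
              (L := p ^ e * (a * r) + 1)
              (fun i hi => M₁.le_weightedOrder_coeff_snd S₁ hi)
              (le_weightedOrder_iff.2 fun d' hd' => hψ d' ?_) (fun i hi => mul_add_one_le hi hr) ?_
            · rintro ⟨rfl, -⟩
              simp [weight_apply_fin_two, mul_comm] at hd'
            · rw [map_nsmul, weight_apply_fin_two, smul_eq_mul]
              simp only [Matrix.cons_val_zero, Matrix.cons_val_one, mul_zero, zero_add]
              refine Nat.lt_succ_of_le (Nat.mul_le_mul_left _ ?_)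
              rw [mul_comm]
              exact Nat.mul_le_mul_left a hd')
      refine ⟨D₂, S₂, M₂, fun d hd => h₂ d ?_⟩
      by_cases hda : a * d 0 < α
      · exact Or.inr (Or.inl hda)
      · rcases Nat.lt_succ_iff_lt_or_eq.1 (hd.resolve_left hda).1 with hd | hd
        · exact Or.inr (Or.inr hd)
        · exact Or.inl ⟨hd, not_lt.1 hda⟩
    · refine ⟨D₁, S₁, M₁, fun d hd => h₁ d (hd.imp_right fun ⟨hd, hda⟩ => ⟨?_, hda⟩)⟩
      rcases Nat.lt_succ_iff_lt_or_eq.1 hd with hd | hd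
      · exact hd
      · exact absurd (hd ▸ hda) hr

/-- A monomial in an initial form that is a `q`-th power has exponent `q • d'`; having survived, it
satisfies `d' 0 ≥ α/a` and `d' 1 ≥ β/a`, so its weight is at least `q μ` at every place. -/
theorem Situation.wellAdapted_of_clear (p e : ℕ) [ExpChar k p]
    (S : Situation R B (p ^ e) D) (M : IsMonomialDatum R B (p ^ e) D.X D.h α β a)
    (hclear : ∀ d : Fin 2 →₀ ℕ, a * d 0 < α ∨ a * d 1 < β →
      MvPowerSeries.coeff (p ^ e • d) (D.a (p ^ e)) = 0) (pt : Place) :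
    WellAdapted R (p ^ e) D pt := by
  have hq : 0 < p ^ e := expChar_pow_pos k p e
  have hX := S.lgs.regular
  rcases le_or_gt (mu R (p ^ e) D pt) (ordRatio (p ^ e) D pt) with hle | hlt
  · exact Or.inl (min_eq_right hle)
  refine Or.inr ⟨min_eq_left hlt.le, hlt, ?_⟩
  rintro ⟨G, hG⟩
  rw [ordRatio, ordAt_plane hX, M.mu_eq hX hq] at hlt
  rcases eq_top_or_exists_eq_natCast ((D.a (p ^ e)).weightedOrder pt.weight) with h | ⟨N, hN⟩
  · rw [h, ENat.toENNReal_top, ENNReal.top_div_of_ne_top (ENNReal.natCast_ne_top _)] at hlt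
    exact not_top_lt hlt
  rw [hN, ENat.toENNReal_coe] at hlt
  obtain ⟨⟨d, hd, hdN⟩, -⟩ := (MvPowerSeries.weightedOrder_eq_nat pt.weight).1 hN
  have hco : MvPowerSeries.coeff d (G ^ p ^ e) ≠ 0 := by
    classical
    rw [hG, initialForm, hN, ENat.toNat_natCast, MvPowerSeries.coeff_weightedHomogeneousComponent,
      if_pos hdN]
    exact hd
  obtain ⟨d', rfl⟩ := exists_eq_smul_of_coeff_pow_expChar_pow_ne_zero p e hco
  have hbig : α ≤ a * d' 0 ∧ β ≤ a * d' 1 := by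
    by_contra hn
    refine hd (hclear d' ?_)
    by_contra! hn'
    exact hn hn'
  refine absurd hlt (not_lt.2 ((natCast_div_le_div_iff M.pos hq).2 ?_))
  rw [← hdN, map_nsmul, weight_apply_fin_two, smul_eq_mul]
  calc (α * pt.weight 0 + β * pt.weight 1) * p ^ e
      ≤ (a * d' 0 * pt.weight 0 + a * d' 1 * pt.weight 1) * p ^ e :=
        Nat.mul_le_mul_right _ (Nat.add_le_add (Nat.mul_le_mul_right _ hbig.1)
          (Nat.mul_le_mul_right _ hbig.2))
    _ = _ := by ring

theorem Situation.exists_wellAdapted [IsAlgClosed k] (p e : ℕ) [ExpChar k p]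
    (S : Situation R B (p ^ e) D) :
    ∃ D' : Choice k, Situation R B (p ^ e) D' ∧ ∀ pt : Place, WellAdapted R (p ^ e) D' pt := by
  obtain ⟨α, β, a, M⟩ := monomialCondition_iff.1 S.monomial
  -- Because `a ≥ 1`, running the inductions up to `α` and `β` covers all relevant exponents.
  have hlt : ∀ {n γ : ℕ}, a * n < γ → n < γ := fun h =>
    lt_of_le_of_lt (Nat.le_mul_of_pos_left _ M.pos) h
  obtain ⟨D₁, S₁, M₁, h₁⟩ := S.exists_clear_fst p e M α
  obtain ⟨D₂, S₂, M₂, h₂⟩ := S₁.exists_clear_snd p e M₁ (fun d hd => h₁ d (hlt hd) hd) β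
  exact ⟨D₂, S₂, S₂.wellAdapted_of_clear p e M₂ fun d hd =>
    h₂ d (hd.imp_right fun h => ⟨hlt h, h⟩)⟩

end MonomialCase

end

/-! ### Existence and uniqueness of the invariant -/

theorem proposition5 {k : Type*} [Field k] [IsAlgClosed k] (p : ℕ) [ExpChar k p] (e : ℕ)
    (R : MonomialCase.IdealisticFiltration k) (B : MonomialCase.Boundary k)
    (hP : R.SingularPoint)
    (hsit : ∃ D : MonomialCase.Choice k, MonomialCase.Situation R B (p ^ e) D) :
    (∃ D : MonomialCase.Choice k, MonomialCase.Situation R B (p ^ e) D ∧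
      ∀ pt : MonomialCase.Place, MonomialCase.WellAdapted R (p ^ e) D pt) ∧
    (∀ (pt : MonomialCase.Place) (D D' : MonomialCase.Choice k),
      MonomialCase.Situation R B (p ^ e) D → MonomialCase.WellAdapted R (p ^ e) D pt →
      MonomialCase.Situation R B (p ^ e) D' → MonomialCase.WellAdapted R (p ^ e) D' pt →
      MonomialCase.slope R (p ^ e) D pt = MonomialCase.slope R (p ^ e) D' pt) ∧
    (∃! H : MonomialCase.Place → ENNReal,
      ∀ (pt : MonomialCase.Place) (D : MonomialCase.Choice k),
        MonomialCase.Situation R B (p ^ e) D → MonomialCase.WellAdapted R (p ^ e) D pt →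
        MonomialCase.slope R (p ^ e) D pt = H pt) := by
  obtain ⟨D₀, S₀⟩ := hsit
  obtain ⟨D₁, S₁, W₁⟩ := S₀.exists_wellAdapted p e
  have huniq : ∀ (pt : MonomialCase.Place) (D D' : MonomialCase.Choice k),
      MonomialCase.Situation R B (p ^ e) D → MonomialCase.WellAdapted R (p ^ e) D pt →
      MonomialCase.Situation R B (p ^ e) D' → MonomialCase.WellAdapted R (p ^ e) D' pt →
      MonomialCase.slope R (p ^ e) D pt = MonomialCase.slope R (p ^ e) D' pt :=
    fun pt D D' S W S' W' => le_antisymm (W'.slope_le p e S' S) (W.slope_le p e S S')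
  -- The simultaneously well-adapted choice `D₁` provides a value at every place, and therefore pins
  -- down the function `H`.
  refine ⟨⟨D₁, S₁, W₁⟩, huniq, fun pt => MonomialCase.slope R (p ^ e) D₁ pt,
    fun pt D S W => huniq pt D D₁ S W S₁ (W₁ pt), fun H hH => funext fun pt => ?_⟩
  exact (hH pt D₁ S₁ (W₁ pt)).symm
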